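/- **Setting.** Let $K$ be a field of characteristic $0$, and let $R\subset\mathbb R$ be a $\mathbb Q$-linear subspace with $1\in R$, together with an injective $\mathbb Q$-linear map $R\to K$ fixing $1$, by which $R$ is regarded as a subset of $K$. Let $K_P[[x]]$ be the field of series $y=\sum_\mu c_\mu x^\mu$ with $c_\mu\in K$ and well-ordered support in $R$, with the termwise derivation $(c x^{\mu})^{\bullet}=c\mu x^{\mu-1}$. Consider $$\dot y=f(y)=\sum_{\nu,\sigma}f_{\nu\sigma}x^{\nu}y^{\sigma},\qquad f_{\nu\sigma}\in K,$$ where the set of $\nu\in R$ and the set of $\sigma\in\mathbb Q$ with some $f_{\nu\sigma}\neq0$ are both well ordered. Fix $\mu_0\in R$, $\mu_0\ge0$, $c_0\in K\setminus\{0\}$, and for each occurring $\sigma=p/q$ (lowest terms, $q>0$) a branch $c_0^{\sigma}\in K$ with $(c_0^{\sigma})^q=c_0^{p}$. For $y=c_0x^{\mu_0}(1+u)$ with $u$ of positive order put $y^\sigma=c_0^\sigma x^{\sigma\mu_0}\sum_{n}\binom{\sigma}{n}u^n$. A *continuation* of $c_0x^{\mu_0}$ is a solution $y\in K_P[[x]]$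 of $\dot y=f(y)$ of the form $y=c_0x^{\mu_0}+(\text{terms of higher exponent})$. Sums of coefficients in $f(y)$ are finite sums; if $K$ carries a norm, they may be infinite, unconditionally convergent sums. Let $\mathfrak f(x)=\min\left(\{x-1\}\cup\{\nu+\sigma x: f_{\nu\sigma}\ne0\}\right)$ be the contour function, and let $M$ be the set of $(\nu,\sigma)$ with $f_{\nu\sigma}\neq0$ and $\nu+\sigma\mu_0=\mathfrak f(\mu_0)$. The term $c_0x^{\mu_0}$ is *admitted as the initial term of a proper solution* if one of the following holds. * $\mu_0>0$, $\mathfrak f(\mu_0)=\mu_0-1$, $\sum_{(\nu,\sigma)\in M}f_{\nu\sigma}c_0^{\sigma}=\mu_0c_0$, and either $\mu_0$ is a breaking point of $\mathfrak f$ (two lines of different slopes realize the minimum at $\mu_0$) or $\mu_0=f_{-1,1}\ne 0$. * $\mu_0=0$, $\nu+1>0$ for every occurring $\nu$, and $c_0$ is in the domain: either for each $\nu$ only finitely many $f_{\nu\sigma}$ are nonzero; or $K$ is a complete normed field whose norm extends the absolute value of $\mathbb Q$, and there is a sequence $\sigma_0,\sigma_1,\dots$ of distinct rationals containing all occurring $\sigma$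 with $\limsup_j|\sigma_j|^{1/j}\le1$ and $\limsup_{j}|f_{\nu\sigma_j}c_0^{\sigma_j}|^{1/j}<1$ for every $\nu$ (where $f_{\nu\sigma_j}=0$ if $\sigma_j$ does not occur). If $\mu_0>0$, let $\mu_r=\sum_{(\nu,\sigma)\in M}f_{\nu\sigma}\,\sigma\,c_0^{\sigma}c_0^{-1}\in K$ be the resonant index; $\mu_r>\mu_0$ means that $\mu_r\in R$ and $\mu_r>\mu_0$ in $R$. Let $i_{\max}$ be the set of all $\mu_0+\delta$ with $\delta$ a finite nonempty sum of elements $(\nu+1)+(\sigma-1)\mu_0$ with $f_{\nu\sigma}\neq0$. **Theorem.** Let $c_0x^{\mu_0}$, $\mu_0\ge0$, be admitted as the initial term of a proper solution. 1. If $\mu_0\ne0$ and not $\mu_r>\mu_0$, there is exactly one continuation. 2. If $\mu_0\neq0$, $\mu_r>\mu_0$ and $\mu_r\notin i_{\max}$, then for every $c_r\in K$ there is exactly one continuation whose coefficient at $x^{\mu_r}$ is $c_r$. 3. If $\mu_r>\mu_0>0$ and $\mu_r\in i_{\max}$, finitely many steps decide between the alternatives of case 2 and termination. Precisely, the set of $\mu\in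 i_{\max}$ with $\mu_0<\mu<\mu_r$ and $\mu_r-\mu+\mu_0\in i_{\max}$ is finite; let $\mu_1<\dots<\mu_N$ be its elements, put $Y_0=c_0x^{\mu_0}$ and $$Y_k=Y_{k-1}+\frac{[x^{\mu_k-1}]f(Y_{k-1})}{\mu_k-\mu_r}\,x^{\mu_k}\qquad(1\le k\le N).$$ For $0\le k\le N$ and every $m\in R$, only finitely many triples $(\nu,\sigma,n)$ contribute to $[x^m]f(Y_k)$ in the expansion $\sum f_{\nu\sigma}c_0^\sigma\binom{\sigma}{n}x^{\nu+\sigma\mu_0}u^n$, where $Y_k=c_0x^{\mu_0}(1+u)$. Every continuation has the same coefficients as $Y_N$ at $\mu_1,\dots,\mu_N$. If $[x^{\mu_r-1}]f(Y_N)=0$, then for every $c_r\in K$ there is exactly one continuation whose coefficient at $x^{\mu_r}$ is $c_r$. If $[x^{\mu_r-1}]f(Y_N)\neq0$, there is no continuation (negative resonance). 4. If $\mu_0=0$, there is exactly one continuation. -/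

import Mathlib

open scoped HahnSeries

noncomputable section

namespace PuiseuxODE

/-- The exponent group `R_K` of generalised Puiseux series over a field `K` of characteristic zero:
a `ℚ`-linear subspace of `ℝ` containing `1`, with its inherited order, together with an injection
`ι` of `ℚ`-linear spaces into `K` that fixes `1` (it is used to differentiate `x ^ μ`). -/
structure Exponents (K : Type*) [Field K] [CharZero K] where
  carrier : Submodule ℚ ℝ
  one_mem : (1 : ℝ) ∈ carrier
  ι : carrier →ₗ[ℚ] K
  ι_injective : Function.Injective ι
  ι_one : ι ⟨1, one_mem⟩ = 1

/- Coefficients: an arbitrary field of characteristic zero, with a norm that only serves to give a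
meaning to infinite sums of coefficients. Every field has the trivial norm, for which the convergent
sums are the finite ones; this is the purely algebraic case. -/
variable {K : Type*} [NormedField K] [CharZero K]

/-- The index set `R_K` as a type. -/
abbrev Exponents.Idx (E : Exponents K) : Type := E.carrier

/-- The exponent `1` of `x`. -/
def Exponents.one (E : Exponents K) : E.Idx := ⟨1, E.one_mem⟩

/-- The field `K_P[[x]]`: series in `x` over `K` with well ordered sets of exponents in `R_K`. -/
abbrev Puiseux (E : Exponents K) : Type _ := HahnSeries E.Idx K

/-- The derivation `(c x ^ μ)˙ = c μ x ^ (μ - 1)`, applied termwise. -/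
def deriv {E : Exponents K} (y : Puiseux E) : Puiseux E where
  coeff m := E.ι (m + E.one) * y.coeff (m + E.one)
  isPWO_support' := by
    refine (y.isPWO_support.image_of_monotone
      (f := fun m => m - E.one) (fun a b h => sub_le_sub_right h _)).mono ?_
    intro m hm
    exact ⟨m + E.one, right_ne_zero_of_mul hm, add_sub_cancel_right _ _⟩

/-- The right-hand side `f = ∑ f_{νσ} x ^ ν y ^ σ`, with `ν ∈ R_K` and `σ ∈ ℚ`; the set of
exponents of `x` that occur and the set of exponents of `y` that occur are well ordered. -/
structure RightSide (E : Exponents K) where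
  coeff : E.Idx → ℚ → K
  isWF_x : {ν | ∃ σ, coeff ν σ ≠ 0}.IsWF
  isWF_y : {σ | ∃ ν, coeff ν σ ≠ 0}.IsWF

variable {E : Exponents K}

/-- A choice of branches at `c₀`: a value `β σ` of `c₀ ^ σ` for each exponent `σ` of `y`. -/
def IsBranch (f : RightSide E) (c₀ : K) (β : ℚ → K) : Prop :=
  ∀ σ : ℚ, (∃ ν, f.coeff ν σ ≠ 0) → β σ ^ σ.den = c₀ ^ σ.num

/-- The series `1 + u` in `y = c₀ x ^ μ₀ (1 + u)`. -/
def normalized (μ₀ : E.Idx) (c₀ : K) (y : Puiseux E) : Puiseux E :=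
  HahnSeries.single (-μ₀) c₀⁻¹ * y

/-- The power `y ^ σ = c₀ ^ σ x ^ (σ μ₀) ∑ₙ (σ choose n) u ^ n` of `y = c₀ x ^ μ₀ (1 + u)`, where
`u` has positive order, on the branch with `c₀ ^ σ = β σ`. -/
def branchPow (μ₀ : E.Idx) (c₀ : K) (β : ℚ → K) (y : Puiseux E) (σ : ℚ) : Puiseux E :=
  HahnSeries.single (σ • μ₀) (β σ) *
    (HahnSeries.SummableFamily.binomialFamily (normalized μ₀ c₀ y) σ).hsum

/-- The term coming from `f_{νσ} x ^ ν y ^ σ` in the coefficient of `x ^ m` in `f(y)`. -/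
def substTerm (f : RightSide E) (μ₀ : E.Idx) (c₀ : K) (β : ℚ → K) (y : Puiseux E)
    (m : E.Idx) (p : E.Idx × ℚ) : K :=
  f.coeff p.1 p.2 * (branchPow μ₀ c₀ β y p.2).coeff (m - p.1)

/-- `y = c₀ x ^ μ₀ + (terms of higher exponent)` is a solution of `ẏ = f(y)`: for every `m` the
terms of the coefficient of `x ^ m` in `f(y)` are summable in `K`, and their sum is the coefficient
of `x ^ m` in `ẏ`. For the trivial norm on `K`, summable means finitely many nonzero terms. -/
def IsContinuation (f : RightSide E) (μ₀ : E.Idx) (c₀ : K) (β : ℚ → K) (y : Puiseux E) : Prop :=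
  y.coeff μ₀ = c₀ ∧ (∀ μ < μ₀, y.coeff μ = 0) ∧
    ∀ m, HasSum (substTerm f μ₀ c₀ β y m) ((deriv y).coeff m)

/-- The values at `x` of the lines `ν + σ x` (with `f_{νσ} ≠ 0`) and `x - 1`. -/
def contourValues (f : RightSide E) (x : E.Idx) : Set E.Idx :=
  {m | m = x - E.one ∨ ∃ ν σ, f.coeff ν σ ≠ 0 ∧ m = ν + σ • x}

/-- The value at `x` of the contour function, the minimum of all these lines, is `m`. -/
def IsContourValue (f : RightSide E) (x m : E.Idx) : Prop :=
  IsLeast (contourValues f x) m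

/-- `x` is a breaking point of the contour function: lines of two different slopes realize the
minimum at `x`. -/
def IsBreakingPoint (f : RightSide E) (x : E.Idx) : Prop :=
  {s : ℚ | ∃ m, IsContourValue f x m ∧
    ((s = 1 ∧ m = x - E.one) ∨ ∃ ν, f.coeff ν s ≠ 0 ∧ m = ν + s • x)}.Nontrivial

/-- The pairs `(ν, σ)` with `f_{νσ} ≠ 0` whose line realizes the contour function at `x`. -/
def minimizers (f : RightSide E) (x : E.Idx) : Set (E.Idx × ℚ) :=
  {p | f.coeff p.1 p.2 ≠ 0 ∧ IsContourValue f x (p.1 + p.2 • x)}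

/-- The resonant index `μ_r = ∑ f_{νσ} c₀ ^ (σ - 1) σ`, an element of `K`; the sum is over the
`(ν, σ)` that realize the contour function at `μ₀`. -/
def resonance (f : RightSide E) (μ₀ : E.Idx) (c₀ : K) (β : ℚ → K) : K :=
  ∑ᶠ p ∈ minimizers f μ₀, f.coeff p.1 p.2 * (β p.2 * c₀⁻¹) * (p.2 : K)

/-- The domain condition on a constant initial term `c₀` (with branches `β σ = c₀ ^ σ`). Either each
power of `x` is multiplied by only finitely many powers of `y`; or `K` is complete, its norm extends
the absolute value of `ℚ`, and for an enumeration `σ₀, σ₁, …` of (at least) the exponents of `y`,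
growing subexponentially, `limsup_j |f_{ν σ_j} c₀ ^ σ_j| ^ (1 / j) < 1` for all `ν`. -/
def InDomain (f : RightSide E) (β : ℚ → K) : Prop :=
  (∀ ν, {σ | f.coeff ν σ ≠ 0}.Finite) ∨
  (CompleteSpace K ∧ (∀ q : ℚ, ‖(q : K)‖ = |(q : ℝ)|) ∧
    ∃ e : ℕ → ℚ, Function.Injective e ∧ (∀ ν σ, f.coeff ν σ ≠ 0 → σ ∈ Set.range e) ∧
      (∀ q : ℝ, 1 < q → ∀ᶠ j in Filter.atTop, |(e j : ℝ)| ≤ q ^ j) ∧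
      ∀ ν, ∃ q : ℝ, q < 1 ∧ ∀ᶠ j in Filter.atTop, ‖f.coeff ν (e j) * β (e j)‖ ≤ q ^ j)

/-- `c₀ x ^ μ₀`, with `μ₀ ≥ 0`, is admitted as the initial term of a proper solution. If `μ₀ = 0`,
all exponents `ν` of `x` satisfy `ν + 1 > 0` and `c₀` is in the domain. If `μ₀ > 0`, the contour
function at `μ₀` is `μ₀ - 1`, either `μ₀` is a breaking point or `μ₀ = f_{-1,1} ≠ 0`, and the vertex
equation `∑ f_{νσ} c₀ ^ σ = μ₀ c₀` holds. -/
def IsProperInitial (f : RightSide E) (μ₀ : E.Idx) (c₀ : K) (β : ℚ → K) : Prop :=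
  c₀ ≠ 0 ∧ IsBranch f c₀ β ∧
  ((μ₀ = 0 ∧ (∀ ν, (∃ σ, f.coeff ν σ ≠ 0) → 0 < ν + E.one) ∧ InDomain f β) ∨
   (0 < μ₀ ∧ IsContourValue f μ₀ (μ₀ - E.one) ∧
    (IsBreakingPoint f μ₀ ∨ (f.coeff (-E.one) 1 ≠ 0 ∧ E.ι μ₀ = f.coeff (-E.one) 1)) ∧
    (∑ᶠ p ∈ minimizers f μ₀, f.coeff p.1 p.2 * β p.2) - E.ι μ₀ * c₀ = 0))

/-- The set `i_max(c₀ x ^ μ₀)`: `μ₀` plus all finite nonempty sums of numbers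
`(ν + 1) + (σ - 1) μ₀` with `f_{νσ} ≠ 0`. -/
def iMax (f : RightSide E) (μ₀ : E.Idx) : Set E.Idx :=
  {μ | ∃ δ ∈ AddSubsemigroup.closure
      {d : E.Idx | ∃ ν σ, f.coeff ν σ ≠ 0 ∧ d = (ν + E.one) + (σ - 1) • μ₀}, μ = δ + μ₀}

/-- The coefficient of `x ^ m` in `f(y)` when it is a finite sum. -/
def rhsCoeff (f : RightSide E) (μ₀ : E.Idx) (c₀ : K) (β : ℚ → K) (y : Puiseux E)
    (m : E.Idx) : K :=
  ∑ᶠ p, substTerm f μ₀ c₀ β y m p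

/-- The triples `(ν, σ, n)` contributing to the coefficient of `x ^ m` in the expansion
`f(y) = ∑ f_{νσ} x ^ ν c₀ ^ σ x ^ (σ μ₀) (σ choose n) u ^ n`, for `y = c₀ x ^ μ₀ (1 + u)`. -/
def contributions (f : RightSide E) (μ₀ : E.Idx) (c₀ : K) (y : Puiseux E) (m : E.Idx) :
    Set (E.Idx × ℚ × ℕ) :=
  {t | f.coeff t.1 t.2.1 ≠ 0 ∧
    ((normalized μ₀ c₀ y - 1) ^ t.2.2).coeff (m - t.1 - t.2.1 • μ₀) ≠ 0}

/-- The exponents strictly between `μ₀` and `ρ` that occur in a decomposition of `ρ`: those `μ` in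
`i_max` such that `(ρ - μ₀) - (μ - μ₀)` is again in `i_max - μ₀`. -/
def levels (f : RightSide E) (μ₀ ρ : E.Idx) : Set E.Idx :=
  {μ | μ ∈ iMax f μ₀ ∧ μ₀ < μ ∧ μ < ρ ∧ ρ - μ + μ₀ ∈ iMax f μ₀}

/-- One step: given the finite sum `y` found so far, solve the coefficient equation
`μ c = μ_r c + (coefficient of x ^ (μ - 1) in f(y))` for `c`, and add `c x ^ μ` to `y`. -/
def step (f : RightSide E) (μ₀ : E.Idx) (c₀ : K) (β : ℚ → K) (y : Puiseux E) (μ : E.Idx) :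
    Puiseux E :=
  y + HahnSeries.single μ
    (rhsCoeff f μ₀ c₀ β y (μ - E.one) / (E.ι μ - resonance f μ₀ c₀ β))

/-- The finite sum obtained from `c₀ x ^ μ₀` by carrying out the steps for a list of exponents. -/
def runSteps (f : RightSide E) (μ₀ : E.Idx) (c₀ : K) (β : ℚ → K) (L : List E.Idx) : Puiseux E :=
  L.foldl (step f μ₀ c₀ β) (HahnSeries.single μ₀ c₀)

end PuiseuxODE

end

/-! Write `y = c₀ x ^ μ₀ (1 + u)` with `u` of positive order, and compare coefficients of `x ^ (μ₀ -
1 + s)`. For `s < 0` both sides vanish, and `s = 0` is the vertex equation. For `s > 0` the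
coefficient `u_s` enters the right-hand side only linearly, through terms of relative exponent `0`,
with total factor `r c₀` (`r` the resonant index). Moved to the left, it leaves `(μ₀ + s - r) c₀ u_s
= remainder u s`, where the remainder involves only `u_t` with `t < s`
(`IsRegular.isContinuation_iff`, `remainder_congr`).

This triangular system is solved by recursion along a well-ordered monoid of exponents
(`exists_solution`), and two solutions cannot differ first at a nonresonant exponent
(`eq_of_solutions`). As `ι` is injective, the factor vanishes for at most one `s`. There the
equation reads `0 = remainder`: either it holds and `u_s` is free, or there is no solution.

To decide which, note that below the resonance the exponents of `u` lie in the monoid generated by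
the relative exponents (`mem_of_solution`). If the resonant exponent lies outside the monoid, the
remainder vanishes. Otherwise the remainder depends only on `u_t` for proper summands `t` of that
exponent within the monoid. There are finitely many, and a summand of a summand is again one, so a
finite computation on these exponents alone yields the exact value (`runSteps_spec`).

Coefficient sums are finite for `μ₀ > 0` because all exponent sets are well ordered; for `μ₀ = 0`
the domain condition makes them converge. In that case `r = 0` and no positive exponent is resonant.
-/

noncomputable section

namespace PuiseuxODE

set_option linter.unusedSectionVars false

/-! ### Powers of a series of positive order. -/

section Local

variable {Γ K : Type*} [AddCommGroup Γ] [LinearOrder Γ] [IsOrderedAddMonoid Γ]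

section Ring

variable [CommRing K]

/-- All exponents of `u` are positive. -/
def PosSupport (u : HahnSeries Γ K) : Prop := ∀ t ≤ 0, u.coeff t = 0

theorem PosSupport.pos {u : HahnSeries Γ K} (hu : PosSupport u) {t : Γ} (ht : u.coeff t ≠ 0) :
    0 < t := by
  by_contra h
  exact ht (hu t (not_lt.1 h))

theorem posSupport_iff_orderTop {u : HahnSeries Γ K} : PosSupport u ↔ 0 < u.orderTop := by
  constructor
  · intro h
    by_contra hn
    have h0 : u ≠ 0 := by
      rintro rfl
      exact hn (by simp)
    rw [HahnSeries.zero_lt_orderTop_iff h0, not_lt] at hn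
    exact h0 (HahnSeries.coeff_order_eq_zero.1 (h _ hn))
  · intro h t ht
    exact HahnSeries.coeff_eq_zero_of_lt_orderTop (lt_of_le_of_lt (by exact_mod_cast ht) h)

theorem exists_of_coeff_mul_ne_zero {u v : HahnSeries Γ K} {g : Γ} (h : (u * v).coeff g ≠ 0) :
    ∃ i j, u.coeff i ≠ 0 ∧ v.coeff j ≠ 0 ∧ i + j = g :=
  let ⟨i, hi, j, hj, e⟩ := HahnSeries.support_mul_subset h
  ⟨i, j, hi, hj, e⟩

theorem pow_support_subset {S : AddSubmonoid Γ} {u : HahnSeries Γ K}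
    (hu : ∀ t, u.coeff t ≠ 0 → t ∈ S) (n : ℕ) {g : Γ} (hg : (u ^ n).coeff g ≠ 0) : g ∈ S :=
  (AddSubmonoid.closure_le.2 hu) (HahnSeries.SummableFamily.support_pow_subset_closure u n hg)

theorem PosSupport.pow_succ {u : HahnSeries Γ K} (hu : PosSupport u) (n : ℕ) :
    PosSupport (u ^ (n + 1)) := by
  intro t ht
  by_contra h
  rw [_root_.pow_succ] at h
  obtain ⟨i, j, hi, hj, rfl⟩ := exists_of_coeff_mul_ne_zero h
  have h1 := hu.pos hj
  have h2 : i ∈ AddSubmonoid.nonneg Γ := pow_support_subset (fun t ht => (hu.pos ht).le) n hi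
  exact absurd ht (not_le.2 (add_pos_of_nonneg_of_pos h2 h1))

theorem pow_succ_sub_pow_succ (u v : HahnSeries Γ K) (n : ℕ) :
    u ^ (n + 1) - v ^ (n + 1) = u * (u ^ n - v ^ n) + (u - v) * v ^ n := by ring

theorem exists_of_coeff_pow_succ_ne {u v : HahnSeries Γ K} {n : ℕ} {g : Γ}
    (h : (u ^ (n + 1)).coeff g ≠ (v ^ (n + 1)).coeff g) :
    (∃ i j, u.coeff i ≠ 0 ∧ (u ^ n).coeff j ≠ (v ^ n).coeff j ∧ i + j = g) ∨
    ∃ i j, u.coeff i ≠ v.coeff i ∧ (v ^ n).coeff j ≠ 0 ∧ i + j = g := by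
  rw [← sub_ne_zero, ← HahnSeries.coeff_sub, pow_succ_sub_pow_succ, HahnSeries.coeff_add] at h
  by_cases h1 : (u * (u ^ n - v ^ n)).coeff g = 0
  · rw [h1, zero_add] at h
    obtain ⟨i, j, hi, hj, e⟩ := exists_of_coeff_mul_ne_zero h
    exact Or.inr ⟨i, j, by rwa [HahnSeries.coeff_sub, sub_ne_zero] at hi, hj, e⟩
  · obtain ⟨i, j, hi, hj, e⟩ := exists_of_coeff_mul_ne_zero h1
    exact Or.inl ⟨i, j, hi, by rwa [HahnSeries.coeff_sub, sub_ne_zero] at hj, e⟩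

/-- Coefficients of powers depend only on the coefficients at exponents that occur in a
decomposition. -/
theorem coeff_pow_congr {S : AddSubmonoid Γ} {I : Set Γ}
    (hI : ∀ a ∈ S, ∀ b ∈ S, a + b ∈ I → a ∈ I ∧ b ∈ I) {u v : HahnSeries Γ K}
    (hu : ∀ t, u.coeff t ≠ 0 → t ∈ S) (hv : ∀ t, v.coeff t ≠ 0 → t ∈ S)
    (h : ∀ t ∈ I, u.coeff t = v.coeff t) (n : ℕ) :
    ∀ g ∈ I, (u ^ n).coeff g = (v ^ n).coeff g := by
  have key : ∀ (n : ℕ) (g : Γ), (u ^ n).coeff g ≠ (v ^ n).coeff g → g ∈ S := by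
    intro n g hg
    by_contra hS
    have h1 : (u ^ n).coeff g = 0 := by
      by_contra h1
      exact hS (pow_support_subset hu n h1)
    have h2 : (v ^ n).coeff g = 0 := by
      by_contra h1
      exact hS (pow_support_subset hv n h1)
    exact hg (h1.trans h2.symm)
  induction n with
  | zero => intros; simp
  | succ n ih =>
    intro g hg
    by_contra hne
    rcases exists_of_coeff_pow_succ_ne hne with ⟨i, j, hi, hj, rfl⟩ | ⟨i, j, hi, hj, rfl⟩
    · exact hj (ih j (hI i (hu i hi) j (key n j hj) hg).2)
    · exact hi (h i (hI i (key 1 i (by simpa using hi)) j (pow_support_subset hv n hj) hg).1)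

/-- The exponents other than `s` that occur in a decomposition of `s` in the monoid `S`. -/
def parts (S : AddSubmonoid Γ) (s : Γ) : Set Γ := {t | t ∈ S ∧ s - t ∈ S ∧ t ≠ s}

/-- A summand of a summand is a summand. Nonnegativity of `S` keeps it proper: if `a = s`, then `b`
must be `0`, so `a + b = s` as well. -/
theorem parts_add {S : AddSubmonoid Γ} (hS : ∀ t ∈ S, 0 ≤ t) {s : Γ} :
    ∀ a ∈ S, ∀ b ∈ S, a + b ∈ parts S s → a ∈ parts S s ∧ b ∈ parts S s := by
  have key : ∀ a ∈ S, ∀ b ∈ S, a + b ∈ parts S s → a ∈ parts S s := by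
    rintro a ha b hb ⟨-, h2, h3⟩
    refine ⟨ha, by convert S.add_mem hb h2 using 1; abel, ?_⟩
    rintro rfl
    have h4 : 0 ≤ a - (a + b) := hS _ h2
    have h5 : b = 0 := le_antisymm (by simpa using h4) (hS b hb)
    exact h3 (by simp [h5])
  exact fun a ha b hb h => ⟨key a ha b hb h, key b hb a ha (by rwa [add_comm])⟩

theorem lt_of_mem_parts {S : AddSubmonoid Γ} (hS : ∀ t ∈ S, 0 ≤ t) {s t : Γ}
    (h : t ∈ parts S s) : t < s :=
  lt_of_le_of_ne (sub_nonneg.1 (hS _ h.2.1)) h.2.2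

/-- The coefficient of `x ^ s` in a power with exponent at least `2` does not depend on the
coefficient of `x ^ s`. -/
theorem coeff_pow_congr_top {S : AddSubmonoid Γ} (hS : ∀ t ∈ S, 0 ≤ t) {s : Γ}
    {u v : HahnSeries Γ K} (hu : ∀ t, u.coeff t ≠ 0 → t ∈ S) (hv : ∀ t, v.coeff t ≠ 0 → t ∈ S)
    (hup : PosSupport u) (hvp : PosSupport v)
    (h : ∀ t ∈ parts S s, u.coeff t = v.coeff t) {n : ℕ} (hn : n ≠ 1) :
    (u ^ n).coeff s = (v ^ n).coeff s := by
  match n, hn with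
  | 0, _ => simp
  | n + 2, _ =>
    by_contra hne
    -- In either product the cofactor of the differing coefficient has positive exponent, so that
    -- coefficient sits at a proper summand of `s`; this is where an exponent of at least `2` is
    -- used.
    rcases exists_of_coeff_pow_succ_ne hne with ⟨i, j, hi, hj, rfl⟩ | ⟨i, j, hi, hj, rfl⟩
    · have hjS : j ∈ S := by
        by_contra hjS
        refine hj ?_
        rw [not_ne_iff.1 fun h => hjS (pow_support_subset hu _ h),
          not_ne_iff.1 fun h => hjS (pow_support_subset hv _ h)]
      refine hj (coeff_pow_congr (parts_add hS) hu hv h _ j ⟨hjS, ?_, ?_⟩)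
      · simpa using hu i hi
      · simpa using (hup.pos hi).ne'
    · have hj0 := (hvp.pow_succ n).pos hj
      have hiS : i ∈ S := by
        by_contra hiS
        refine hi ?_
        rw [not_ne_iff.1 fun h => hiS (hu _ h), not_ne_iff.1 fun h => hiS (hv _ h)]
      refine hi (h i ⟨hiS, ?_, ?_⟩)
      · simpa using pow_support_subset hv _ hj
      · simpa using hj0.ne'

theorem coeff_pow_finite {u : HahnSeries Γ K} (hu : PosSupport u) (g : Γ) :
    {n : ℕ | (u ^ n).coeff g ≠ 0}.Finite :=
  HahnSeries.SummableFamily.pow_finite_co_support (posSupport_iff_orderTop.1 hu) g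

/-- The series with coefficients `w` on the partially well ordered set `S`, and `0` elsewhere. -/
def restrict (S : Set Γ) (hS : S.IsPWO) (w : Γ → K) : HahnSeries Γ K where
  coeff := S.indicator w
  isPWO_support' := hS.mono Set.support_indicator_subset

theorem coeff_restrict_of_mem {S : Set Γ} (hS : S.IsPWO) (w : Γ → K) {t : Γ} (ht : t ∈ S) :
    (restrict S hS w).coeff t = w t := Set.indicator_of_mem ht w

theorem coeff_restrict_of_notMem {S : Set Γ} (hS : S.IsPWO) (w : Γ → K) {t : Γ} (ht : t ∉ S) :
    (restrict S hS w).coeff t = 0 := Set.indicator_of_notMem ht w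

/-- The part of `u` with exponents less than `s`. -/
def cut (u : HahnSeries Γ K) (s : Γ) : HahnSeries Γ K :=
  restrict (u.support ∩ Set.Iio s) (u.isPWO_support.mono Set.inter_subset_left) u.coeff

theorem coeff_cut_of_lt (u : HahnSeries Γ K) {s t : Γ} (h : t < s) :
    (cut u s).coeff t = u.coeff t := by
  by_cases h0 : t ∈ u.support
  · exact coeff_restrict_of_mem _ _ ⟨h0, h⟩
  · refine (coeff_restrict_of_notMem _ _ fun h => h0 h.1).trans ?_
    rw [HahnSeries.mem_support, not_ne_iff] at h0
    exact h0.symm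

theorem coeff_cut_ne_zero {u : HahnSeries Γ K} {s t : Γ} (h : (cut u s).coeff t ≠ 0) :
    u.coeff t ≠ 0 ∧ t < s := by
  by_contra h1
  exact h (coeff_restrict_of_notMem _ _ h1)

theorem PosSupport.cut {u : HahnSeries Γ K} (hu : PosSupport u) (s : Γ) :
    PosSupport (cut u s) := by
  intro t ht
  by_contra h
  exact (coeff_cut_ne_zero h).1 (hu t ht)

end Ring

/-! ### Coefficients of binomial powers. -/

variable [Field K] [CharZero K]

/-- The coefficient of `x ^ g` in `(1 + u) ^ r`. -/
def binomCoeff (u : HahnSeries Γ K) (r : ℚ) (g : Γ) : K :=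
  ∑ᶠ n : ℕ, Ring.choose r n • (u ^ n).coeff g

theorem binomCoeff_finite {u : HahnSeries Γ K} (hu : PosSupport u) (r : ℚ) (g : Γ) :
    Function.HasFiniteSupport fun n : ℕ => Ring.choose r n • (u ^ n).coeff g := by
  refine (coeff_pow_finite hu g).subset ?_
  intro n hn h
  exact hn (by simp [h])

/-- For `d = 0` only the power `n = 1` sees `u.coeff s`, and the subtracted term is exactly that
contribution. For `d ≠ 0` the exponent `s - d` is already a proper summand of `s`, or lies outside
`S`, where all powers vanish. -/
theorem binomCoeff_congr {S : AddSubmonoid Γ} (hS : ∀ t ∈ S, 0 ≤ t) {s d : Γ}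
    (hd : d ∈ S) {u v : HahnSeries Γ K} (hu : ∀ t, u.coeff t ≠ 0 → t ∈ S)
    (hv : ∀ t, v.coeff t ≠ 0 → t ∈ S) (hup : PosSupport u) (hvp : PosSupport v)
    (h : ∀ t ∈ parts S s, u.coeff t = v.coeff t) (r : ℚ) :
    binomCoeff u r (s - d) - (if d = 0 then (r : K) * u.coeff s else 0) =
      binomCoeff v r (s - d) - (if d = 0 then (r : K) * v.coeff s else 0) := by
  by_cases hd0 : d = 0
  · subst hd0
    simp only [sub_zero, if_true]
    rw [sub_eq_sub_iff_sub_eq_sub, binomCoeff, binomCoeff, ← finsum_sub_distrib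
      (binomCoeff_finite hup r s) (binomCoeff_finite hvp r s), finsum_eq_single _ 1]
    · simp [Rat.smul_def]
    · intro n hn
      rw [coeff_pow_congr_top hS hu hv hup hvp h hn, sub_self]
  · simp only [hd0, if_false, sub_zero]
    refine finsum_congr fun n => ?_
    congr 1
    by_cases hsd : s - d ∈ S
    · refine coeff_pow_congr (parts_add hS) hu hv h n _ ⟨hsd, by simpa using hd, by simpa using hd0⟩
    · rw [not_ne_iff.1 fun h => hsd (pow_support_subset hu _ h),
        not_ne_iff.1 fun h => hsd (pow_support_subset hv _ h)]

theorem exists_pow_coeff_of_binomCoeff_ne_zero {u : HahnSeries Γ K} {r : ℚ} {g : Γ}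
    (h : binomCoeff u r g ≠ 0) : ∃ n : ℕ, (u ^ n).coeff g ≠ 0 := by
  by_contra! hn
  exact h (by simp [binomCoeff, hn])

theorem mem_of_binomCoeff_ne_zero {S : AddSubmonoid Γ} {u : HahnSeries Γ K}
    (hu : ∀ t, u.coeff t ≠ 0 → t ∈ S) {r : ℚ} {g : Γ} (h : binomCoeff u r g ≠ 0) : g ∈ S :=
  let ⟨n, hn⟩ := exists_pow_coeff_of_binomCoeff_ne_zero h
  pow_support_subset hu n hn

theorem binomCoeff_zero_right {u : HahnSeries Γ K} (hu : PosSupport u) (r : ℚ) :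
    binomCoeff u r 0 = 1 := by
  rw [binomCoeff, finsum_eq_single _ 0]
  · simp
  · intro n hn
    obtain ⟨m, rfl⟩ := Nat.exists_eq_succ_of_ne_zero hn
    rw [(hu.pow_succ m) 0 le_rfl, smul_zero]

/-! ### The triangular system of coefficient equations. -/

variable [TopologicalSpace K] {A : Type*} (a : A → K) (σ : A → ℚ) (d : A → Γ)

/-- The coefficient of `x ^ s` in `∑ₚ aₚ x ^ dₚ (1 + u) ^ σₚ`, without the contribution of the
coefficient of `x ^ s` in `u`. -/
def remainder (u : HahnSeries Γ K) (s : Γ) : K :=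
  ∑' p, a p * (binomCoeff u (σ p) (s - d p) - (if d p = 0 then (σ p : K) * u.coeff s else 0))

variable {a σ d}

/-- The terms agree one by one, so no convergence is needed. Allowing a general `S`, rather than all
nonnegative exponents, is what later reduces the resonance test to finitely many coefficients. -/
theorem remainder_congr {S : AddSubmonoid Γ} (hS : ∀ t ∈ S, 0 ≤ t) (hd : ∀ p, a p ≠ 0 → d p ∈ S)
    {s : Γ} {u v : HahnSeries Γ K} (hu : ∀ t, u.coeff t ≠ 0 → t ∈ S)
    (hv : ∀ t, v.coeff t ≠ 0 → t ∈ S) (hup : PosSupport u) (hvp : PosSupport v)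
    (h : ∀ t ∈ parts S s, u.coeff t = v.coeff t) :
    remainder a σ d u s = remainder a σ d v s := by
  refine tsum_congr fun p => ?_
  by_cases hp : a p = 0
  · simp [hp]
  · rw [binomCoeff_congr hS (hd p hp) hu hv hup hvp h]

theorem remainder_congr_of_lt (hd : ∀ p, a p ≠ 0 → 0 ≤ d p)
    {s : Γ} {u v : HahnSeries Γ K} (hup : PosSupport u) (hvp : PosSupport v)
    (h : ∀ t < s, u.coeff t = v.coeff t) : remainder a σ d u s = remainder a σ d v s :=
  remainder_congr (S := AddSubmonoid.nonneg Γ) (fun _ h => h) hd (fun _ h => (hup.pos h).le)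
    (fun _ h => (hvp.pos h).le) hup hvp fun t ht => h t (lt_of_mem_parts (fun _ h => h) ht)

theorem remainder_eq_zero {S : AddSubmonoid Γ} (hd : ∀ p, a p ≠ 0 → d p ∈ S) {s : Γ} (hs : s ∉ S)
    {u : HahnSeries Γ K} (hu : ∀ t, u.coeff t ≠ 0 → t ∈ S) : remainder a σ d u s = 0 := by
  rw [remainder, ← tsum_zero (α := K) (β := A)]
  refine tsum_congr fun p => ?_
  by_cases hp : a p = 0
  · simp [hp]
  · have h : binomCoeff u (σ p) (s - d p) = 0 := by
      by_contra h
      refine hs ?_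
      simpa using S.add_mem (mem_of_binomCoeff_ne_zero hu h) (hd p hp)
    rw [not_ne_iff.1 fun h => hs (hu s h), h]
    simp

/-- A solution is determined by its coefficients at the resonant exponents. -/
theorem eq_of_solutions (hd : ∀ p, a p ≠ 0 → 0 ≤ d p) {κ : Γ → K} {u v : HahnSeries Γ K}
    (hup : PosSupport u) (hvp : PosSupport v)
    (hu : ∀ s, 0 < s → κ s * u.coeff s = remainder a σ d u s)
    (hv : ∀ s, 0 < s → κ s * v.coeff s = remainder a σ d v s)
    (h : ∀ s, 0 < s → κ s = 0 → u.coeff s = v.coeff s) : u = v := by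
  by_contra hne
  have h0 : u - v ≠ 0 := sub_ne_zero.2 hne
  -- The lowest exponent at which the two series differ: the remainders agree there.
  set s := (u - v).order with hs
  have h1 : u.coeff s ≠ v.coeff s := by
    rw [← sub_ne_zero, ← HahnSeries.coeff_sub]
    exact fun h => h0 (HahnSeries.coeff_order_eq_zero.1 h)
  have h2 : ∀ t < s, u.coeff t = v.coeff t := by
    intro t ht
    rw [← sub_eq_zero, ← HahnSeries.coeff_sub]
    exact HahnSeries.coeff_eq_zero_of_lt_order ht
  have h3 : 0 < s := by
    by_contra h3
    exact h1 ((hup s (not_lt.1 h3)).trans (hvp s (not_lt.1 h3)).symm)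
  have h4 : κ s * u.coeff s = κ s * v.coeff s := by
    rw [hu s h3, hv s h3, remainder_congr_of_lt hd hup hvp h2]
  by_cases hk : κ s = 0
  · exact h1 (h s h3 hk)
  · exact h1 (mul_left_cancel₀ hk h4)

/-- Below the first resonance, the exponents of a solution lie in the monoid generated by the
exponents of the equation. -/
theorem mem_of_solution {S : AddSubmonoid Γ} (hS : ∀ t ∈ S, 0 ≤ t) (hd : ∀ p, a p ≠ 0 → d p ∈ S)
    {κ : Γ → K} {u : HahnSeries Γ K} (hup : PosSupport u) {ρ : Γ}
    (hu : ∀ s, 0 < s → s < ρ → κ s ≠ 0 ∧ κ s * u.coeff s = remainder a σ d u s) :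
    ∀ t, t < ρ → u.coeff t ≠ 0 → t ∈ S := by
  intro t htρ ht
  revert htρ
  -- At a least exponent `s` outside `S`, the truncation below `s` is supported in `S`, so the
  -- remainder at `s` vanishes; as `κ s ≠ 0`, this forces `u.coeff s = 0`.
  refine u.isWF_support.induction (P := fun t => t < ρ → t ∈ S) ht fun s hs ih htρ => ?_
  by_contra hsS
  have h1 : ∀ t, (cut u s).coeff t ≠ 0 → t ∈ S := by
    intro t ht
    obtain ⟨h2, h3⟩ := coeff_cut_ne_zero ht
    exact ih t h2 h3 (h3.trans htρ)
  obtain ⟨hk, he⟩ := hu s (hup.pos hs) htρ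
  rw [← remainder_congr_of_lt (fun p hp => hS _ (hd p hp)) (hup.cut s) hup
    (fun t ht => coeff_cut_of_lt u ht), remainder_eq_zero hd hsS h1] at he
  exact (mul_ne_zero hk hs) he

/-- Existence of a series that solves the equation at all nonresonant exponents, with prescribed
coefficients at the resonant ones. -/
theorem exists_solution {S : AddSubmonoid Γ} (hS : ∀ t ∈ S, 0 ≤ t) (hSp : (S : Set Γ).IsPWO)
    (hd : ∀ p, a p ≠ 0 → d p ∈ S) (κ c : Γ → K) :
    ∃ u : HahnSeries Γ K, PosSupport u ∧
      (∀ s, 0 < s → κ s ≠ 0 → κ s * u.coeff s = remainder a σ d u s) ∧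
      (∀ s, 0 < s → κ s = 0 → s ∈ S → u.coeff s = c s) := by
  classical
  have hwf : WellFounded (fun x y : S => x < y) := hSp.isWF
  let S' : Set Γ := S ∩ Set.Ioi 0
  have hS' : S'.IsPWO := hSp.mono Set.inter_subset_left
  -- The remainder is evaluated on the series of coefficients found so far, with `0` at `x` and
  -- above; by `remainder_congr_of_lt` this gives the same value as the full series.
  let F : (x : S) → ((y : S) → y < x → K) → K := fun x rec =>
    if κ x = 0 then c x else remainder a σ d
      (restrict S' hS' fun t => if h : ∃ ht : t ∈ S, (⟨t, ht⟩ : S) < x then rec ⟨t, h.1⟩ h.2 else 0)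
      (x : Γ) / κ x
  obtain ⟨W, hW⟩ : ∃ W : S → K, ∀ x, W x = F x fun y _ => W y := ⟨hwf.fix F, hwf.fix_eq F⟩
  let u := restrict S' hS' fun t => if h : t ∈ S then W ⟨t, h⟩ else 0
  have hpos : ∀ w : Γ → K, PosSupport (restrict S' hS' w) := fun w t ht =>
    coeff_restrict_of_notMem _ _ fun h => absurd ht (not_le.2 h.2)
  have hu : ∀ s (hs : s ∈ S), 0 < s →
      u.coeff s = if κ s = 0 then c s else remainder a σ d u s / κ s := by
    intro s hs h0
    have h1 : u.coeff s = W ⟨s, hs⟩ := by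
      refine (coeff_restrict_of_mem hS' _ ⟨hs, h0⟩).trans ?_
      rw [dif_pos hs]
    rw [h1, hW]
    dsimp only [F]
    split_ifs with hk
    · rfl
    · congr 1
      refine remainder_congr_of_lt (fun p hp => hS _ (hd p hp)) (hpos _) (hpos _) ?_
      intro t ht
      by_cases h2 : t ∈ S'
      · have h3 : t ∈ S := h2.1
        rw [coeff_restrict_of_mem hS' _ h2, coeff_restrict_of_mem hS' _ h2, dif_pos ⟨h3, ht⟩,
          dif_pos h3]
      · rw [coeff_restrict_of_notMem hS' _ h2, coeff_restrict_of_notMem hS' _ h2]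
  refine ⟨u, hpos _, ?_, ?_⟩
  · intro s h0 hk
    by_cases hs : s ∈ S
    · rw [hu s hs h0, if_neg hk, mul_div_cancel₀ _ hk]
    -- Outside `S` both sides of the equation are zero.
    · have h1 : ∀ t, u.coeff t ≠ 0 → t ∈ S := by
        intro t ht
        by_contra hn
        exact ht (coeff_restrict_of_notMem _ _ fun h => hn h.1)
      rw [remainder_eq_zero hd hs h1, not_ne_iff.1 fun h => hs (h1 s h), mul_zero]
  · intro s h0 hk hs
    rw [hu s hs h0, if_pos hk]

end Local

/-! ### From the differential equation to the coefficient equations. -/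

section Translation

variable {K : Type*} [NormedField K] [CharZero K] {E : Exponents K}

/-- The exponent `(ν + 1) + (σ - 1) μ₀` of `x` relative to `x ^ (μ₀ - 1)` in the lowest term of
`x ^ ν y ^ σ`. -/
def relExp (μ₀ : E.Idx) (p : E.Idx × ℚ) : E.Idx := (p.1 + E.one) + (p.2 - 1) • μ₀

/-- The coefficient `f_{νσ} c₀ ^ σ`. -/
def weight (f : RightSide E) (β : ℚ → K) (p : E.Idx × ℚ) : K := f.coeff p.1 p.2 * β p.2

/-- The series `u` in `y = c₀ x ^ μ₀ (1 + u)`. -/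
def tail (μ₀ : E.Idx) (c₀ : K) (y : Puiseux E) : Puiseux E := normalized μ₀ c₀ y - 1

/-- The series `c₀ x ^ μ₀ (1 + u)`. -/
def ofTail (μ₀ : E.Idx) (c₀ : K) (u : Puiseux E) : Puiseux E := HahnSeries.single μ₀ c₀ * (1 + u)

/-- The initial term of `y` is `c₀ x ^ μ₀`. -/
def HasInitial (μ₀ : E.Idx) (c₀ : K) (y : Puiseux E) : Prop :=
  y.coeff μ₀ = c₀ ∧ ∀ μ < μ₀, y.coeff μ = 0

variable {f : RightSide E} {μ₀ : E.Idx} {c₀ : K} {β : ℚ → K}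

theorem weight_ne_zero {p : E.Idx × ℚ} (h : weight f β p ≠ 0) : f.coeff p.1 p.2 ≠ 0 :=
  left_ne_zero_of_mul h

theorem coeff_tail (y : Puiseux E) (t : E.Idx) :
    (tail μ₀ c₀ y).coeff t = c₀⁻¹ * y.coeff (μ₀ + t) - if t = 0 then 1 else 0 := by
  rw [tail, normalized, HahnSeries.coeff_sub, HahnSeries.coeff_single_mul, HahnSeries.coeff_one,
    sub_neg_eq_add, add_comm t]
  split_ifs <;> rfl

theorem coeff_eq_of_tail (hc : c₀ ≠ 0) (y : Puiseux E) (t : E.Idx) :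
    y.coeff (μ₀ + t) = c₀ * ((tail μ₀ c₀ y).coeff t + if t = 0 then 1 else 0) := by
  rw [coeff_tail, sub_add_cancel, mul_inv_cancel_left₀ hc]

theorem coeff_eq_of_tail_of_ne (hc : c₀ ≠ 0) (y : Puiseux E) {t : E.Idx} (ht : t ≠ μ₀) :
    y.coeff t = c₀ * (tail μ₀ c₀ y).coeff (t - μ₀) := by
  have h := coeff_eq_of_tail (μ₀ := μ₀) hc y (t - μ₀)
  rwa [if_neg (sub_ne_zero.2 ht), add_zero, add_sub_cancel] at h

theorem tail_injective (hc : c₀ ≠ 0) {y z : Puiseux E} (h : tail μ₀ c₀ y = tail μ₀ c₀ z) :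
    y = z := by
  ext t
  rw [← add_sub_cancel μ₀ t, coeff_eq_of_tail hc, coeff_eq_of_tail hc, h]

theorem tail_ofTail (hc : c₀ ≠ 0) (u : Puiseux E) : tail μ₀ c₀ (ofTail μ₀ c₀ u) = u := by
  rw [tail, normalized, ofTail, ← mul_assoc, HahnSeries.single_mul_single, neg_add_cancel,
    inv_mul_cancel₀ hc]
  rw [show HahnSeries.single (0 : E.Idx) (1 : K) = 1 from rfl]
  ring

theorem posSupport_tail_iff (hc : c₀ ≠ 0) {y : Puiseux E} :
    PosSupport (tail μ₀ c₀ y) ↔ HasInitial μ₀ c₀ y := by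
  constructor
  · intro h
    constructor
    · have := coeff_eq_of_tail (μ₀ := μ₀) hc y 0
      rwa [h 0 le_rfl, if_pos rfl, zero_add, mul_one, add_zero] at this
    · intro μ hμ
      rw [coeff_eq_of_tail_of_ne hc y hμ.ne, h _ (sub_nonpos.2 hμ.le), mul_zero]
  · rintro ⟨h1, h2⟩ t ht
    rw [coeff_tail]
    rcases ht.eq_or_lt with rfl | ht
    · rw [add_zero, h1, if_pos rfl, inv_mul_cancel₀ hc, sub_self]
    · rw [h2 _ (add_lt_of_neg_right μ₀ ht), if_neg ht.ne, mul_zero, sub_zero]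

theorem substTerm_eq {y : Puiseux E} (hy : PosSupport (tail μ₀ c₀ y)) (m : E.Idx)
    (p : E.Idx × ℚ) :
    substTerm f μ₀ c₀ β y m p =
      weight f β p * binomCoeff (tail μ₀ c₀ y) p.2 (m + E.one - μ₀ - relExp μ₀ p) := by
  have h1 : m - p.1 - p.2 • μ₀ = m + E.one - μ₀ - relExp μ₀ p := by
    rw [relExp, sub_smul, one_smul]
    abel
  rw [substTerm, branchPow, HahnSeries.coeff_single_mul, h1, weight, mul_assoc, binomCoeff,
    HahnSeries.SummableFamily.coeff_hsum]
  congr 2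
  refine finsum_congr fun n => ?_
  rw [HahnSeries.SummableFamily.binomialFamily_apply (posSupport_iff_orderTop.1 hy)]
  rfl

/-- The properties of the initial term `c₀ x ^ μ₀` used in solving for the coefficients; `r` is the
resonant index. -/
structure IsRegular (f : RightSide E) (μ₀ : E.Idx) (c₀ : K) (β : ℚ → K) (r : K) : Prop where
  ne_zero : c₀ ≠ 0
  nonneg : ∀ p : E.Idx × ℚ, f.coeff p.1 p.2 ≠ 0 → 0 ≤ relExp μ₀ p
  isPWO : {d | ∃ p : E.Idx × ℚ, f.coeff p.1 p.2 ≠ 0 ∧ relExp μ₀ p = d}.IsPWO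
  summable : ∀ u : Puiseux E, PosSupport u → ∀ s,
    Summable fun p => weight f β p * binomCoeff u p.2 (s - relExp μ₀ p)
  finite : {p : E.Idx × ℚ | f.coeff p.1 p.2 ≠ 0 ∧ relExp μ₀ p = 0}.Finite
  vertex : ∑ᶠ p ∈ {p : E.Idx × ℚ | f.coeff p.1 p.2 ≠ 0 ∧ relExp μ₀ p = 0}, weight f β p =
    E.ι μ₀ * c₀
  resonant : ∑ᶠ p ∈ {p : E.Idx × ℚ | f.coeff p.1 p.2 ≠ 0 ∧ relExp μ₀ p = 0},
    weight f β p * (p.2 : K) = r * c₀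

theorem hasSum_finsum_mem {ι : Type*} {Z : Set ι} (hZ : Z.Finite) {g h : ι → K}
    (h1 : ∀ p ∈ Z, h p = g p) (h2 : ∀ p ∉ Z, h p = 0) : HasSum h (∑ᶠ p ∈ Z, g p) := by
  rw [finsum_mem_congr rfl fun p hp => (h1 p hp).symm, finsum_mem_eq_finite_toFinset_sum _ hZ]
  exact hasSum_sum_of_ne_finset_zero fun p hp => h2 p (by simpa using hp)

/-- The factor of the coefficient of `x ^ s` in `u`, in the coefficient equation at the exponent
`μ₀ - 1 + s`. -/
def multiplier (μ₀ : E.Idx) (c₀ r : K) (s : E.Idx) : K := (E.ι (μ₀ + s) - r) * c₀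

/-- The monoid generated by the relative exponents of the terms of the equation. -/
def relExpMonoid (f : RightSide E) (μ₀ : E.Idx) : AddSubmonoid E.Idx :=
  AddSubmonoid.closure {d | ∃ p : E.Idx × ℚ, f.coeff p.1 p.2 ≠ 0 ∧ relExp μ₀ p = d}

theorem relExp_mem_monoid {p : E.Idx × ℚ} (hp : weight f β p ≠ 0) :
    relExp μ₀ p ∈ relExpMonoid f μ₀ :=
  AddSubmonoid.subset_closure ⟨p, weight_ne_zero hp, rfl⟩

variable {r : K}

namespace IsRegular

/-- The linear contributions of `u.coeff s` come from the finitely many terms of relative exponent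
`0`, and they add up to the resonant index times `c₀`. -/
theorem tsum_eq (h : IsRegular f μ₀ c₀ β r) {u : Puiseux E} (hu : PosSupport u) (s : E.Idx) :
    ∑' p, weight f β p * binomCoeff u p.2 (s - relExp μ₀ p) =
      remainder (weight f β) Prod.snd (relExp μ₀) u s + r * c₀ * u.coeff s := by
  have h1 : HasSum (fun p : E.Idx × ℚ =>
      weight f β p * if relExp μ₀ p = 0 then (p.2 : K) * u.coeff s else 0) (r * c₀ * u.coeff s) := by
    rw [← h.resonant]
    have h2 := (hasSum_finsum_mem h.finite (g := fun p => weight f β p * (p.2 : K))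
      (h := fun p => weight f β p * if relExp μ₀ p = 0 then (p.2 : K) else 0)
      (fun p hp => by simp only [if_pos hp.2]) (fun p hp => by
        by_cases hw : weight f β p = 0
        · simp [hw]
        · rw [if_neg fun h0 => hp ⟨weight_ne_zero hw, h0⟩, mul_zero])).mul_right (u.coeff s)
    refine h2.congr_fun ?_
    intro p
    split_ifs <;> ring
  have h3 : HasSum _ _ := ((h.summable u hu s).hasSum).sub h1
  rw [remainder, ← sub_eq_iff_eq_add, ← h3.tsum_eq]
  refine tsum_congr fun p => ?_
  rw [mul_sub]
  split_ifs <;> rfl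

theorem isContinuation_iff (h : IsRegular f μ₀ c₀ β r) {y : Puiseux E} :
    IsContinuation f μ₀ c₀ β y ↔ PosSupport (tail μ₀ c₀ y) ∧ ∀ s, 0 < s →
      multiplier μ₀ c₀ r s * (tail μ₀ c₀ y).coeff s =
        remainder (weight f β) Prod.snd (relExp μ₀) (tail μ₀ c₀ y) s := by
  rw [IsContinuation, ← and_assoc, ← HasInitial, ← posSupport_tail_iff h.ne_zero]
  refine and_congr_right fun hy => ?_
  have key : ∀ s, 0 < s → (HasSum (substTerm f μ₀ c₀ β y (μ₀ + s - E.one))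
      ((deriv y).coeff (μ₀ + s - E.one)) ↔ multiplier μ₀ c₀ r s * (tail μ₀ c₀ y).coeff s =
        remainder (weight f β) Prod.snd (relExp μ₀) (tail μ₀ c₀ y) s) := by
    intro s hs
    have h1 : substTerm f μ₀ c₀ β y (μ₀ + s - E.one) = fun p =>
        weight f β p * binomCoeff (tail μ₀ c₀ y) p.2 (s - relExp μ₀ p) := by
      funext p
      rw [substTerm_eq hy]
      congr 2
      abel
    rw [h1, (h.summable _ hy s).hasSum_iff, h.tsum_eq hy]
    change _ = E.ι (μ₀ + s - E.one + E.one) * y.coeff (μ₀ + s - E.one + E.one) ↔ _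
    rw [sub_add_cancel, coeff_eq_of_tail h.ne_zero, if_neg hs.ne', add_zero, multiplier]
    constructor <;> intro h <;> linear_combination -h
  constructor
  · exact fun H s hs => (key s hs).1 (H _)
  · intro H m
    -- With `s = m + 1 - μ₀`: the case `s > 0` is the system, `s = 0` the vertex equation, and for
    -- `s < 0` every term vanishes because relative exponents are nonnegative.
    rcases lt_trichotomy 0 (m + E.one - μ₀) with hs | hs | hs
    · have := (key _ hs).2 (H _ hs)
      rwa [show μ₀ + (m + E.one - μ₀) - E.one = m by abel] at this
    · have hm : m + E.one = μ₀ := (sub_eq_zero.1 hs.symm)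
      change HasSum _ (E.ι (m + E.one) * y.coeff (m + E.one))
      have h0 := coeff_eq_of_tail (μ₀ := μ₀) h.ne_zero y 0
      rw [hy 0 le_rfl, if_pos rfl, zero_add, mul_one, add_zero] at h0
      rw [hm, h0, ← h.vertex]
      refine hasSum_finsum_mem h.finite ?_ ?_
      · rintro p ⟨-, hp⟩
        rw [substTerm_eq hy, hm, hp, sub_self, sub_zero, binomCoeff_zero_right hy, mul_one]
      · intro p hp
        rw [substTerm_eq hy, hm]
        by_contra hne
        have hw := weight_ne_zero (left_ne_zero_of_mul hne)
        have hB : μ₀ - μ₀ - relExp μ₀ p ∈ AddSubmonoid.nonneg E.Idx :=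
          mem_of_binomCoeff_ne_zero (fun t ht => (hy.pos ht).le) (right_ne_zero_of_mul hne)
        rw [sub_self, zero_sub, AddSubmonoid.mem_nonneg, neg_nonneg] at hB
        exact hp ⟨hw, le_antisymm hB (h.nonneg p hw)⟩
    · change HasSum _ (E.ι (m + E.one) * y.coeff (m + E.one))
      rw [((posSupport_tail_iff h.ne_zero).1 hy).2 _ (sub_neg.1 hs), mul_zero]
      convert hasSum_zero using 1
      funext p
      rw [substTerm_eq hy]
      by_contra hne
      have hw := weight_ne_zero (left_ne_zero_of_mul hne)
      have hB : m + E.one - μ₀ - relExp μ₀ p ∈ AddSubmonoid.nonneg E.Idx :=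
        mem_of_binomCoeff_ne_zero (fun t ht => (hy.pos ht).le) (right_ne_zero_of_mul hne)
      rw [AddSubmonoid.mem_nonneg, sub_nonneg] at hB
      exact absurd (hB.trans_lt hs) (not_lt.2 (h.nonneg p hw))

theorem monoid_nonneg (h : IsRegular f μ₀ c₀ β r) : ∀ t ∈ relExpMonoid f μ₀, 0 ≤ t :=
  (AddSubmonoid.closure_le (S := AddSubmonoid.nonneg E.Idx)).2
    (by rintro _ ⟨p, hp, rfl⟩; exact h.nonneg p hp)

/-- Adjoining `e` to the generators gives it a place in the recursion even when the equation itself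
does not produce it. The enlarged monoid is still well ordered, as `e` is positive. -/
theorem exists_partial_solution (h : IsRegular f μ₀ c₀ β r) (e : E.Idx) (he : 0 < e) (c : K) :
    ∃ u : Puiseux E, PosSupport u ∧ (∀ s, 0 < s → multiplier μ₀ c₀ r s ≠ 0 →
        multiplier μ₀ c₀ r s * u.coeff s = remainder (weight f β) Prod.snd (relExp μ₀) u s) ∧
      (multiplier μ₀ c₀ r e = 0 → u.coeff e = c) := by
  set D := {d | ∃ p : E.Idx × ℚ, f.coeff p.1 p.2 ≠ 0 ∧ relExp μ₀ p = d}
  have h1 : ∀ t ∈ insert e D, 0 ≤ t := by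
    rintro t (rfl | ⟨p, hp, rfl⟩)
    · exact he.le
    · exact h.nonneg p hp
  obtain ⟨u, hu, h2, h3⟩ := exists_solution (S := AddSubmonoid.closure (insert e D))
    (a := weight f β) (σ := Prod.snd) (d := relExp μ₀)
    (AddSubmonoid.closure_le (S := AddSubmonoid.nonneg E.Idx).2 h1)
    (Set.IsPWO.addSubmonoid_closure h1 (h.isPWO.insert e))
    (fun p hp => AddSubmonoid.subset_closure (Or.inr ⟨p, weight_ne_zero hp, rfl⟩))
    (multiplier μ₀ c₀ r) (fun _ => c)
  exact ⟨u, hu, h2, fun hk => h3 e he hk (AddSubmonoid.subset_closure (Or.inl rfl))⟩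

theorem eq_of_isContinuation (h : IsRegular f μ₀ c₀ β r) {y z : Puiseux E}
    (hy : IsContinuation f μ₀ c₀ β y) (hz : IsContinuation f μ₀ c₀ β z)
    (hyz : ∀ ρ, μ₀ < ρ → E.ι ρ = r → y.coeff ρ = z.coeff ρ) : y = z := by
  rw [h.isContinuation_iff] at hy hz
  refine tail_injective h.ne_zero (eq_of_solutions (fun p hp => h.nonneg p (weight_ne_zero hp))
    hy.1 hz.1 hy.2 hz.2 fun s hs hk => ?_)
  rw [coeff_tail, coeff_tail, hyz _ (lt_add_of_pos_right μ₀ hs)]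
  exact sub_eq_zero.1 ((mul_eq_zero.1 hk).resolve_right h.ne_zero)

theorem existsUnique_of_not_resonant (h : IsRegular f μ₀ c₀ β r)
    (hr : ∀ ρ, μ₀ < ρ → E.ι ρ ≠ r) : ∃! y : Puiseux E, IsContinuation f μ₀ c₀ β y := by
  have h01 : (0 : E.Idx) < E.one := by
    change (0 : ℝ) < 1
    exact one_pos
  -- Any positive exponent would do here; nothing is prescribed.
  obtain ⟨u, hu, h1, -⟩ := h.exists_partial_solution E.one h01 0
  refine ⟨ofTail μ₀ c₀ u, ?_, fun z hz => ?_⟩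
  · change IsContinuation _ _ _ _ _
    rw [h.isContinuation_iff, tail_ofTail h.ne_zero]
    exact ⟨hu, fun s hs => h1 s hs (mul_ne_zero
      (sub_ne_zero.2 (hr _ (lt_add_of_pos_right μ₀ hs))) h.ne_zero)⟩
  · refine h.eq_of_isContinuation hz ?_ fun ρ h1 h2 => absurd h2 (hr ρ h1)
    rw [h.isContinuation_iff, tail_ofTail h.ne_zero]
    exact ⟨hu, fun s hs => h1 s hs (mul_ne_zero
      (sub_ne_zero.2 (hr _ (lt_add_of_pos_right μ₀ hs))) h.ne_zero)⟩

theorem multiplier_ne_zero (h : IsRegular f μ₀ c₀ β r) {ρ : E.Idx} (hρ : E.ι ρ = r) {s : E.Idx}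
    (hs : s ≠ ρ - μ₀) : multiplier μ₀ c₀ r s ≠ 0 := by
  refine mul_ne_zero (sub_ne_zero.2 fun h1 => hs ?_) h.ne_zero
  rw [← E.ι_injective (h1.trans hρ.symm)]
  abel

/-- At the resonance the equation reduces to `0 = remainder`. The hypothesis `h0` supplies this for
every solution of the lower equations, so the coefficient there can be chosen freely, and it then
fixes all the others. -/
theorem existsUnique_of_resonant (h : IsRegular f μ₀ c₀ β r) {ρ : E.Idx} (hρ : E.ι ρ = r)
    (hlt : μ₀ < ρ) (h0 : ∀ u : Puiseux E, PosSupport u → (∀ s, 0 < s → s < ρ - μ₀ →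
      multiplier μ₀ c₀ r s * u.coeff s = remainder (weight f β) Prod.snd (relExp μ₀) u s) →
      remainder (weight f β) Prod.snd (relExp μ₀) u (ρ - μ₀) = 0) (c : K) :
    ∃! y : Puiseux E, IsContinuation f μ₀ c₀ β y ∧ y.coeff ρ = c := by
  obtain ⟨u, hu, h1, h2⟩ := h.exists_partial_solution (ρ - μ₀) (sub_pos.2 hlt) (c₀⁻¹ * c)
  have h3 : multiplier μ₀ c₀ r (ρ - μ₀) = 0 := by
    rw [multiplier, add_sub_cancel, hρ, sub_self, zero_mul]
  have h4 : IsContinuation f μ₀ c₀ β (ofTail μ₀ c₀ u) := by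
    rw [h.isContinuation_iff, tail_ofTail h.ne_zero]
    refine ⟨hu, fun s hs => ?_⟩
    by_cases hsρ : s = ρ - μ₀
    · rw [hsρ, h3, zero_mul, h0 u hu fun s hs h4 => h1 s hs (h.multiplier_ne_zero hρ h4.ne)]
    · exact h1 s hs (h.multiplier_ne_zero hρ hsρ)
  have h5 : (ofTail μ₀ c₀ u).coeff ρ = c := by
    rw [coeff_eq_of_tail_of_ne h.ne_zero _ hlt.ne', tail_ofTail h.ne_zero, h2 h3,
      mul_inv_cancel_left₀ h.ne_zero]
  refine ⟨_, ⟨h4, h5⟩, fun z hz => h.eq_of_isContinuation hz.1 h4 fun ρ' _ hr => ?_⟩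
  rw [E.ι_injective (hr.trans hρ.symm), hz.2, h5]

/-- A partial solution may be cut off at the resonant exponent; its exponents are then in
`relExpMonoid f μ₀`. -/
theorem exists_cut (h : IsRegular f μ₀ c₀ β r) {ρ : E.Idx} (hρ : E.ι ρ = r) {u : Puiseux E}
    (hu : PosSupport u) (hs : ∀ s, 0 < s → s < ρ - μ₀ →
      multiplier μ₀ c₀ r s * u.coeff s = remainder (weight f β) Prod.snd (relExp μ₀) u s) :
    ∃ w : Puiseux E, PosSupport w ∧ (∀ t, w.coeff t ≠ 0 → t ∈ relExpMonoid f μ₀) ∧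
      (∀ t < ρ - μ₀, w.coeff t = u.coeff t) ∧
      ∀ s ≤ ρ - μ₀, remainder (weight f β) Prod.snd (relExp μ₀) w s =
        remainder (weight f β) Prod.snd (relExp μ₀) u s := by
  refine ⟨cut u (ρ - μ₀), hu.cut _, fun t ht => ?_, fun t ht => coeff_cut_of_lt u ht,
    fun s hs => remainder_congr_of_lt (fun p hp => h.nonneg p (weight_ne_zero hp)) (hu.cut _) hu
      fun t ht => coeff_cut_of_lt u (ht.trans_le hs)⟩
  obtain ⟨h1, h2⟩ := coeff_cut_ne_zero ht
  exact mem_of_solution h.monoid_nonneg (fun p hp => relExp_mem_monoid hp) hu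
    (fun s h0 h1 => ⟨h.multiplier_ne_zero hρ h1.ne, hs s h0 h1⟩) t h2 h1

/-- A partial solution has its exponents below the resonance in the monoid, so it contributes
nothing at an exponent outside the monoid. -/
theorem existsUnique_of_notMem_monoid (h : IsRegular f μ₀ c₀ β r) {ρ : E.Idx} (hρ : E.ι ρ = r)
    (hlt : μ₀ < ρ) (hn : ρ - μ₀ ∉ relExpMonoid f μ₀) (c : K) :
    ∃! y : Puiseux E, IsContinuation f μ₀ c₀ β y ∧ y.coeff ρ = c := by
  refine h.existsUnique_of_resonant hρ hlt (fun u hu hs => ?_) c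
  obtain ⟨w, -, h2, -, h4⟩ := h.exists_cut hρ hu hs
  rw [← h4 _ le_rfl, remainder_eq_zero (fun p hp => relExp_mem_monoid hp) hn h2]

end IsRegular

end Translation

/-! ### Summability and regularity of the admitted initial terms. -/

section Regularity

/-- A crude bound, polynomial in `|q|` for fixed `n`: subexponential growth of the exponents then
cannot spoil geometric decay. The induction uses `(n + 1) (q choose n + 1) = (q choose n) (q - n)`.
-/
theorem abs_choose_le (q : ℚ) (n : ℕ) : |Ring.choose q n| ≤ (|q| + n) ^ n := by
  induction n with
  | zero => simp
  | succ n ih =>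
    have h := Ring.choose_smul_choose q (n.le_succ)
    rw [Nat.succ_eq_add_one, Nat.choose_succ_self_right, Nat.add_sub_cancel_left,
      Ring.choose_one_right, nsmul_eq_mul] at h
    have h1 : |Ring.choose q (n + 1)| ≤ |((n + 1 : ℕ) : ℚ) * Ring.choose q (n + 1)| := by
      rw [abs_mul, Nat.abs_cast]
      exact le_mul_of_one_le_left (abs_nonneg _) (by exact_mod_cast Nat.le_add_left 1 n)
    have h2 : |q - n| ≤ |q| + n := (abs_sub _ _).trans (by rw [Nat.abs_cast])
    have h3 : (0 : ℚ) ≤ |q| + n := by positivity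
    calc |Ring.choose q (n + 1)| ≤ |Ring.choose q n * (q - n)| := by rwa [← h]
      _ ≤ (|q| + n) ^ n * (|q| + n) := by
        rw [abs_mul]
        exact mul_le_mul ih h2 (abs_nonneg _) (pow_nonneg h3 _)
      _ = (|q| + n) ^ (n + 1) := (pow_succ _ _).symm
      _ ≤ (|q| + (n + 1 : ℕ)) ^ (n + 1) := by
        gcongr
        simp

variable {K : Type*} [NormedField K] [CharZero K] {E : Exponents K}

variable {f : RightSide E} {μ₀ : E.Idx} {c₀ : K} {β : ℚ → K}

theorem summable_weight_mul_choose (h : InDomain f β) (ν : E.Idx) (n : ℕ) :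
    Summable fun σ => weight f β (ν, σ) * ((Ring.choose σ n : ℚ) : K) := by
  rcases h with h | ⟨hK, hnorm, e, he, hrange, hgrow, hdom⟩
  · refine summable_of_hasFiniteSupport ((h ν).subset fun σ hσ => ?_)
    exact weight_ne_zero (left_ne_zero_of_mul hσ)
  · rw [← he.summable_iff]
    swap
    · intro σ hσ
      by_contra hne
      exact hσ (hrange ν σ (weight_ne_zero (left_ne_zero_of_mul hne)))
    obtain ⟨q, hq1, hq⟩ := hdom ν
    have hq0 : 0 ≤ q := by
      -- A negative `q` would bound a norm by a negative number at odd `j`.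
      by_contra! hlt
      obtain ⟨N, hN⟩ := Filter.eventually_atTop.1 hq
      have h1 := hN (2 * N + 1) (by omega)
      have h2 : q ^ (2 * N + 1) < 0 := Odd.pow_neg ⟨N, rfl⟩ hlt
      exact absurd ((norm_nonneg _).trans h1) (not_le.2 h2)
    -- Since `|e j| ≤ t ^ j` eventually, the binomial coefficient costs at most a constant times `t
    -- ^ (n j)`; `t` is taken so close to `1` that the ratio `t ^ n * q` stays below `1`.
    obtain ⟨t, ht, ht1⟩ : ∃ t : ℝ, t ^ n * q < 1 ∧ 1 < t := by
      have hc : Filter.Tendsto (fun t : ℝ => t ^ n * q) (nhds 1) (nhds (1 ^ n * q)) :=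
        (Continuous.tendsto (by fun_prop) 1)
      have h1 : ∀ᶠ t : ℝ in nhdsWithin 1 (Set.Ioi 1), t ^ n * q < 1 :=
        (hc.mono_left nhdsWithin_le_nhds).eventually_lt_const (by simpa using hq1)
      exact (h1.and self_mem_nhdsWithin).exists
    have hgeom : Summable fun j : ℕ => (1 + n : ℝ) ^ n * (t ^ n * q) ^ j :=
      (summable_geometric_of_lt_one (by positivity) ht).mul_left _
    refine Summable.of_norm_bounded_eventually_nat hgeom ?_
    filter_upwards [hq, hgrow t ht1] with j h1 h2
    have h3 : ‖((Ring.choose (e j) n : ℚ) : K)‖ ≤ ((1 + n) * t ^ j) ^ n := by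
      rw [hnorm]
      calc |((Ring.choose (e j) n : ℚ) : ℝ)| ≤ (|(e j : ℝ)| + n) ^ n := by
            exact_mod_cast abs_choose_le (e j) n
        _ ≤ _ := by
          gcongr
          have : 1 ≤ t ^ j := one_le_pow₀ ht1.le
          nlinarith [Nat.cast_nonneg (α := ℝ) n]
    calc ‖weight f β (ν, e j) * ((Ring.choose (e j) n : ℚ) : K)‖
        ≤ q ^ j * ((1 + n) * t ^ j) ^ n := by
          rw [norm_mul]
          exact mul_le_mul h1 h3 (norm_nonneg _) (pow_nonneg hq0 _)
      _ = (1 + n : ℝ) ^ n * (t ^ n * q) ^ j := by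
          rw [mul_pow, mul_pow, ← pow_mul, ← pow_mul, mul_comm j n]
          ring

theorem isPWO_closure_support {u : Puiseux E} (hu : PosSupport u) :
    (AddSubmonoid.closure u.support : Set E.Idx).IsPWO :=
  Set.IsPWO.addSubmonoid_closure (fun _ h => (hu.pos h).le) u.isPWO_support

theorem relExp_zero (p : E.Idx × ℚ) : relExp (0 : E.Idx) p = p.1 + E.one := by
  rw [relExp, smul_zero, add_zero]

/-- All relative exponents are `ν + 1 > 0`, so the vertex and resonance sums are empty and the
resonant index is `0`. A fixed exponent receives contributions from finitely many `ν` and, for each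
of them, finitely many powers of `u`; only the sum over `σ` can be infinite. -/
theorem isRegular_zero (hc : c₀ ≠ 0) (hν : ∀ ν, (∃ σ, f.coeff ν σ ≠ 0) → 0 < ν + E.one)
    (hd : InDomain f β) : IsRegular f 0 c₀ β 0 := by
  have hpos : ∀ p : E.Idx × ℚ, f.coeff p.1 p.2 ≠ 0 → 0 < relExp 0 p := fun p hp => by
    rw [relExp_zero]
    exact hν _ ⟨_, hp⟩
  have hZ : {p : E.Idx × ℚ | f.coeff p.1 p.2 ≠ 0 ∧ relExp 0 p = 0} = ∅ :=
    Set.eq_empty_of_forall_notMem fun p hp => (hpos p hp.1).ne' hp.2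
  refine ⟨hc, fun p hp => (hpos p hp).le, ?_, ?_, ?_, ?_, ?_⟩
  · refine (f.isWF_x.isPWO.image_of_monotone (f := fun ν => ν + E.one)
      fun _ _ h => add_le_add_left h _).mono ?_
    rintro _ ⟨p, hp, rfl⟩
    exact ⟨p.1, ⟨_, hp⟩, (relExp_zero p).symm⟩
  · intro u hu s
    classical
    have hN : {ν : E.Idx | (∃ σ, f.coeff ν σ ≠ 0) ∧
        s - (ν + E.one) ∈ AddSubmonoid.closure u.support}.Finite := by
      refine ((Set.AddAntidiagonal.finite_of_isPWO f.isWF_x.isPWO (isPWO_closure_support hu)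
        (s - E.one)).image Prod.fst).subset ?_
      rintro ν ⟨h1, h2⟩
      refine ⟨(ν, s - (ν + E.one)), ⟨h1, h2, ?_⟩, rfl⟩
      simp only
      abel
    have key : (fun p : E.Idx × ℚ => weight f β p * binomCoeff u p.2 (s - relExp 0 p)) =
        fun p => ∑ ν ∈ hN.toFinset, if p.1 = ν then
          weight f β p * binomCoeff u p.2 (s - relExp 0 p) else 0 := by
      funext p
      rw [Finset.sum_ite_eq]
      split_ifs with hp
      · rfl
      · by_contra hne
        refine hp (hN.mem_toFinset.2 ⟨⟨_, weight_ne_zero (left_ne_zero_of_mul hne)⟩, ?_⟩)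
        rw [← relExp_zero p]
        exact mem_of_binomCoeff_ne_zero (fun t ht => AddSubmonoid.subset_closure ht)
          (right_ne_zero_of_mul hne)
    rw [key]
    refine summable_sum fun ν _ => ?_
    rw [← (Prod.mk_right_injective ν).summable_iff]
    swap
    · rintro ⟨ν', σ⟩ hp
      refine if_neg ?_
      rintro rfl
      exact hp ⟨σ, rfl⟩
    have hF := coeff_pow_finite hu (s - (ν + E.one))
    have h1 : ((fun p : E.Idx × ℚ => if p.1 = ν then
          weight f β p * binomCoeff u p.2 (s - relExp 0 p) else 0) ∘ Prod.mk ν) =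
        fun σ => ∑ n ∈ hF.toFinset, weight f β (ν, σ) * ((Ring.choose σ n : ℚ) : K) *
          (u ^ n).coeff (s - (ν + E.one)) := by
      funext σ
      rw [Function.comp_apply, if_pos rfl, relExp_zero, binomCoeff,
        finsum_eq_sum_of_support_subset (s := hF.toFinset), Finset.mul_sum]
      · refine Finset.sum_congr rfl fun n _ => ?_
        rw [Rat.smul_def, mul_assoc]
      · intro n hn
        rw [Set.Finite.coe_toFinset]
        intro h0
        exact hn (by simp only [h0, smul_zero])
    rw [h1]
    exact summable_sum fun n _ => (summable_weight_mul_choose hd ν n).mul_right _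
  · rw [hZ]
    exact Set.finite_empty
  · rw [hZ, finsum_mem_empty, map_zero, zero_mul]
  · rw [hZ, finsum_mem_empty, zero_mul]

theorem smul_strictMono (hμ : 0 < μ₀) : StrictMono fun σ : ℚ => σ • μ₀ := by
  intro a b hab
  change ((a • μ₀ : E.Idx) : ℝ) < ((b • μ₀ : E.Idx) : ℝ)
  have h0 : (0 : ℝ) < μ₀ := hμ
  rw [Submodule.coe_smul, Submodule.coe_smul, Rat.smul_def, Rat.smul_def]
  exact mul_lt_mul_of_pos_right (by exact_mod_cast hab) h0

theorem relExp_eq (p : E.Idx × ℚ) :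
    relExp μ₀ p = p.1 + p.2 • μ₀ - (μ₀ - E.one) := by
  rw [relExp, sub_smul, one_smul]
  abel

theorem isPWO_smul (f : RightSide E) (hμ : 0 < μ₀) :
    ((fun σ : ℚ => σ • μ₀) '' {σ | ∃ ν, f.coeff ν σ ≠ 0}).IsPWO :=
  f.isWF_y.isPWO.image_of_monotone (smul_strictMono hμ).monotone

/-- An element has finitely many decompositions over two well-ordered sets. This is applied twice:
first to split off the element of `C`, then to separate `ν` from `σ • μ₀`. Positivity of `μ₀` keeps
the exponents `σ • μ₀` well ordered and determines `σ` from them. -/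
theorem finite_sub_relExp_mem (f : RightSide E) (hμ : 0 < μ₀) {C : Set E.Idx} (hC : C.IsPWO)
    (s : E.Idx) : {p : E.Idx × ℚ | f.coeff p.1 p.2 ≠ 0 ∧ s - relExp μ₀ p ∈ C}.Finite := by
  have hA := f.isWF_x.isPWO
  have hB := isPWO_smul f hμ
  have hinj : Function.Injective fun p : E.Idx × ℚ => (p.1, p.2 • μ₀) := by
    rintro ⟨a, b⟩ ⟨a', b'⟩ h
    obtain ⟨h1, h2⟩ := Prod.mk.inj h
    exact Prod.ext h1 ((smul_strictMono hμ).injective h2)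
  refine ((Set.AddAntidiagonal.finite_of_isPWO (hA.add hB) hC (s + (μ₀ - E.one))).biUnion
    fun x _ => (Set.AddAntidiagonal.finite_of_isPWO hA hB x.1).preimage hinj.injOn).subset ?_
  rintro p ⟨h1, h2⟩
  refine Set.mem_biUnion (x := (p.1 + p.2 • μ₀, s - relExp μ₀ p)) ?_ ?_
  · refine ⟨Set.add_mem_add ⟨_, h1⟩ ⟨_, ⟨_, h1⟩, rfl⟩, h2, ?_⟩
    rw [relExp_eq]
    simp only
    abel
  · exact ⟨⟨_, h1⟩, ⟨_, ⟨_, h1⟩, rfl⟩, rfl⟩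

theorem finite_binomCoeff_ne_zero (f : RightSide E) (β : ℚ → K) (hμ : 0 < μ₀) {u : Puiseux E}
    (hu : PosSupport u) (s : E.Idx) :
    Function.HasFiniteSupport fun p => weight f β p * binomCoeff u p.2 (s - relExp μ₀ p) :=
  (finite_sub_relExp_mem f hμ (isPWO_closure_support hu) s).subset fun _ hp =>
    ⟨weight_ne_zero (left_ne_zero_of_mul hp), mem_of_binomCoeff_ne_zero
      (fun _ ht => AddSubmonoid.subset_closure ht) (right_ne_zero_of_mul hp)⟩

theorem minimizers_eq (h : IsContourValue f μ₀ (μ₀ - E.one)) :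
    minimizers f μ₀ = {p : E.Idx × ℚ | f.coeff p.1 p.2 ≠ 0 ∧ relExp μ₀ p = 0} := by
  ext p
  refine and_congr_right fun _ => ?_
  rw [relExp_eq, sub_eq_zero]
  exact ⟨fun h1 => h1.unique h, fun h1 => h1 ▸ h⟩

theorem isRegular_of_pos (hc : c₀ ≠ 0) (hμ : 0 < μ₀) (h : IsContourValue f μ₀ (μ₀ - E.one))
    (hv : (∑ᶠ p ∈ minimizers f μ₀, f.coeff p.1 p.2 * β p.2) - E.ι μ₀ * c₀ = 0) :
    IsRegular f μ₀ c₀ β (resonance f μ₀ c₀ β) where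
  ne_zero := hc
  nonneg p hp := by
    rw [relExp_eq, sub_nonneg]
    exact h.2 (Or.inr ⟨_, _, hp, rfl⟩)
  isPWO := by
    refine ((f.isWF_x.isPWO.add (isPWO_smul f hμ)).image_of_monotone
      (f := fun t => t - (μ₀ - E.one)) fun _ _ h => sub_le_sub_right h _).mono ?_
    rintro _ ⟨p, hp, rfl⟩
    exact ⟨_, Set.add_mem_add ⟨_, hp⟩ ⟨_, ⟨_, hp⟩, rfl⟩, (relExp_eq p).symm⟩
  summable u hu s := summable_of_hasFiniteSupport (finite_binomCoeff_ne_zero f β hμ hu s)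
  finite := (finite_sub_relExp_mem f hμ (Set.isPWO_singleton 0) 0).subset fun p hp =>
    ⟨hp.1, by rw [hp.2, sub_zero]; rfl⟩
  vertex := by
    rw [← minimizers_eq h]
    exact sub_eq_zero.1 hv
  resonant := by
    have hfin : (minimizers f μ₀).Finite := by
      rw [minimizers_eq h]
      exact (finite_sub_relExp_mem f hμ (Set.isPWO_singleton 0) 0).subset fun p hp =>
        ⟨hp.1, by rw [hp.2, sub_zero]; rfl⟩
    rw [← minimizers_eq h, resonance, finsum_mem_eq_finite_toFinset_sum _ hfin,
      finsum_mem_eq_finite_toFinset_sum _ hfin, Finset.sum_mul]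
    refine Finset.sum_congr rfl fun p _ => ?_
    rw [weight]
    field_simp

end Regularity

/-! ### The finite procedure at a resonance in `iMax`. -/

section Resonance

variable {K : Type*} [NormedField K] [CharZero K] {E : Exponents K}

variable {f : RightSide E} {μ₀ : E.Idx} {c₀ : K} {β : ℚ → K} {r : K}

theorem sub_mem_monoid_of_mem_iMax {μ : E.Idx} (h : μ ∈ iMax f μ₀) : μ - μ₀ ∈ relExpMonoid f μ₀ := by
  obtain ⟨δ, hδ, rfl⟩ := h
  rw [add_sub_cancel_right]
  refine (AddSubsemigroup.closure_le (S := (relExpMonoid f μ₀).toAddSubsemigroup)).2 ?_ hδ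
  rintro _ ⟨ν, σ, hp, rfl⟩
  exact AddSubmonoid.subset_closure ⟨(ν, σ), hp, rfl⟩

theorem add_mem_iMax_of_mem_monoid {t : E.Idx} (h : t ∈ relExpMonoid f μ₀) (h0 : t ≠ 0) :
    t + μ₀ ∈ iMax f μ₀ := by
  refine ⟨t, (?_ : t = 0 ∨ _).resolve_left h0, rfl⟩
  refine AddSubmonoid.closure_induction (motive := fun t _ => t = 0 ∨ t ∈ AddSubsemigroup.closure _)
    ?_ (Or.inl rfl) ?_ h
  · rintro _ ⟨p, hp, rfl⟩
    exact Or.inr (AddSubsemigroup.subset_closure ⟨_, _, hp, rfl⟩)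
  · rintro a b - - (rfl | ha) (rfl | hb)
    · exact Or.inl (add_zero 0)
    · exact Or.inr (by rwa [zero_add])
    · exact Or.inr (by rwa [add_zero])
    · exact Or.inr (AddSubsemigroup.add_mem _ ha hb)

theorem mem_levels_iff {μ ρ : E.Idx} : μ ∈ levels f μ₀ ρ ↔
    μ - μ₀ ∈ relExpMonoid f μ₀ ∧ μ₀ < μ ∧ μ < ρ ∧ ρ - μ ∈ relExpMonoid f μ₀ := by
  constructor
  · rintro ⟨h1, h2, h3, h4⟩
    refine ⟨sub_mem_monoid_of_mem_iMax h1, h2, h3, ?_⟩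
    simpa using sub_mem_monoid_of_mem_iMax h4
  · rintro ⟨h1, h2, h3, h4⟩
    refine ⟨?_, h2, h3, add_mem_iMax_of_mem_monoid h4 (sub_ne_zero.2 h3.ne')⟩
    simpa using add_mem_iMax_of_mem_monoid h1 (sub_ne_zero.2 h2.ne')

theorem IsRegular.finite_levels (h : IsRegular f μ₀ c₀ β r) (ρ : E.Idx) :
    (levels f μ₀ ρ).Finite := by
  have hp : (relExpMonoid f μ₀ : Set E.Idx).IsPWO :=
    Set.IsPWO.addSubmonoid_closure (by rintro _ ⟨p, hp, rfl⟩; exact h.nonneg p hp) h.isPWO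
  refine ((Set.AddAntidiagonal.finite_of_isPWO hp hp (ρ - μ₀)).image fun x => x.1 + μ₀).subset ?_
  intro μ hμ
  obtain ⟨h1, -, -, h4⟩ := mem_levels_iff.1 hμ
  exact ⟨(μ - μ₀, ρ - μ), ⟨h1, h4, by simp only; abel⟩, by simp only; abel⟩

theorem runSteps_append_singleton (L : List E.Idx) (μ : E.Idx) :
    runSteps f μ₀ c₀ β (L ++ [μ]) = step f μ₀ c₀ β (runSteps f μ₀ c₀ β L) μ := by
  simp [runSteps]

theorem hasInitial_runSteps (L : List E.Idx) (hL : ∀ μ ∈ L, μ₀ < μ) :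
    HasInitial μ₀ c₀ (runSteps f μ₀ c₀ β L) := by
  induction L using List.reverseRecOn with
  | nil =>
    refine ⟨HahnSeries.coeff_single_same μ₀ c₀, fun μ hμ => ?_⟩
    exact HahnSeries.coeff_single_of_ne hμ.ne
  | append_singleton L μ ih =>
    obtain ⟨h1, h2⟩ := ih fun μ hμ => hL μ (List.mem_append_left _ hμ)
    have hμ : μ₀ < μ := hL μ (by simp)
    rw [runSteps_append_singleton, step]
    constructor
    · rw [HahnSeries.coeff_add, HahnSeries.coeff_single_of_ne hμ.ne, h1, add_zero]
    · intro t ht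
      rw [HahnSeries.coeff_add, HahnSeries.coeff_single_of_ne (ht.trans hμ).ne, h2 t ht, add_zero]

theorem finite_contributions (f : RightSide E) (hμ : 0 < μ₀) {y : Puiseux E}
    (hy : PosSupport (tail μ₀ c₀ y)) (m : E.Idx) : (contributions f μ₀ c₀ y m).Finite := by
  refine ((finite_sub_relExp_mem f hμ (isPWO_closure_support hy) (m + E.one - μ₀)).biUnion
    fun p _ => (coeff_pow_finite hy (m + E.one - μ₀ - relExp μ₀ p)).image
      fun n => (p.1, p.2, n)).subset ?_
  rintro ⟨ν, σ, n⟩ ⟨h1, h2⟩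
  have h3 : m - ν - σ • μ₀ = m + E.one - μ₀ - relExp μ₀ (ν, σ) := by
    rw [relExp_eq]
    simp only
    abel
  simp only at h1 h2
  rw [h3] at h2
  exact Set.mem_biUnion (x := (ν, σ))
    ⟨h1, pow_support_subset (fun _ ht => AddSubmonoid.subset_closure ht) n h2⟩ ⟨n, h2, rfl⟩

/-- When the coefficient at `μ` is still zero, the linear term is absent, so the number computed by
a step is the remainder itself. -/
theorem IsRegular.rhsCoeff_eq (h : IsRegular f μ₀ c₀ β r) (hμ : 0 < μ₀) {y : Puiseux E}
    (hy : PosSupport (tail μ₀ c₀ y)) (μ : E.Idx) (h0 : (tail μ₀ c₀ y).coeff (μ - μ₀) = 0) :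
    rhsCoeff f μ₀ c₀ β y (μ - E.one) =
      remainder (weight f β) Prod.snd (relExp μ₀) (tail μ₀ c₀ y) (μ - μ₀) := by
  have h1 := h.tsum_eq hy (μ - μ₀)
  rw [h0, mul_zero, add_zero, tsum_eq_finsum (finite_binomCoeff_ne_zero f β hμ hy _)] at h1
  rw [← h1, rhsCoeff]
  refine finsum_congr fun p => ?_
  rw [substTerm_eq hy, sub_add_cancel]

/-- If `ρ - μ` is in the monoid, every nonzero proper summand `t` of `μ - μ₀` gives a level `μ₀ + t`
of `ρ`. Hence the levels form a closed subsystem: other exponents of a solution never influence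
them. -/
theorem IsRegular.remainder_eq_of_levels (h : IsRegular f μ₀ c₀ β r) {ρ : E.Idx}
    {u w : Puiseux E} (hu : PosSupport u) (hw : PosSupport w)
    (hus : ∀ t, u.coeff t ≠ 0 → t ∈ relExpMonoid f μ₀)
    (hws : ∀ t, w.coeff t ≠ 0 → t ∈ relExpMonoid f μ₀)
    {μ : E.Idx} (hμρ : μ ≤ ρ) (hμ : ρ - μ ∈ relExpMonoid f μ₀)
    (huw : ∀ t, μ₀ + t ∈ levels f μ₀ ρ → μ₀ + t < μ → u.coeff t = w.coeff t) :
    remainder (weight f β) Prod.snd (relExp μ₀) u (μ - μ₀) =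
      remainder (weight f β) Prod.snd (relExp μ₀) w (μ - μ₀) := by
  refine remainder_congr h.monoid_nonneg (fun p hp => relExp_mem_monoid hp) hus hws hu hw ?_
  intro t ht
  have hlt := lt_of_mem_parts h.monoid_nonneg ht
  obtain ⟨h1, h2, -⟩ := ht
  rcases (h.monoid_nonneg t h1).eq_or_lt with rfl | h0
  · rw [hu 0 le_rfl, hw 0 le_rfl]
  · have h3 : μ₀ + t < μ := lt_sub_iff_add_lt'.1 hlt
    refine huw t (mem_levels_iff.2 ⟨by rwa [add_sub_cancel_left], lt_add_of_pos_right _ h0,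
      h3.trans_le hμρ, ?_⟩) h3
    convert (relExpMonoid f μ₀).add_mem hμ h2 using 1
    abel

/-- The steps reproduce the coefficients of every partial solution at the levels. -/
theorem coeff_tail_runSteps (h : IsRegular f μ₀ c₀ β (resonance f μ₀ c₀ β)) (hμ₀ : 0 < μ₀)
    {ρ : E.Idx} (hρ : E.ι ρ = resonance f μ₀ c₀ β) {L : List E.Idx} (hL : L.Pairwise (· < ·))
    (hlev : ∀ μ, μ ∈ L ↔ μ ∈ levels f μ₀ ρ) {w : Puiseux E} (hw : PosSupport w)
    (hws : ∀ t, w.coeff t ≠ 0 → t ∈ relExpMonoid f μ₀)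
    (hsol : ∀ s, 0 < s → s < ρ - μ₀ → multiplier μ₀ c₀ (resonance f μ₀ c₀ β) s * w.coeff s =
      remainder (weight f β) Prod.snd (relExp μ₀) w s) (L' : List E.Idx) (hL' : L' <+: L) :
    ∀ t, (μ₀ + t ∈ L' → (tail μ₀ c₀ (runSteps f μ₀ c₀ β L')).coeff t = w.coeff t) ∧
      (μ₀ + t ∉ L' → (tail μ₀ c₀ (runSteps f μ₀ c₀ β L')).coeff t = 0) := by
  induction L' using List.reverseRecOn with
  | nil =>
    intro t
    refine ⟨fun h => absurd h List.not_mem_nil, fun _ => ?_⟩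
    rw [coeff_tail, runSteps, List.foldl_nil]
    by_cases ht : t = 0
    · rw [ht, add_zero, HahnSeries.coeff_single_same, if_pos rfl, inv_mul_cancel₀ h.ne_zero,
        sub_self]
    · rw [HahnSeries.coeff_single_of_ne (by simpa using ht), if_neg ht, mul_zero, sub_zero]
  | append_singleton L' μ ih =>
    have hpre : L' <+: L := (List.prefix_append _ _).trans hL'
    specialize ih hpre
    set y := runSteps f μ₀ c₀ β L' with hy
    obtain ⟨R, hR⟩ := hL'
    have hμL : μ ∈ levels f μ₀ ρ := (hlev μ).1 (by rw [← hR]; simp)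
    obtain ⟨-, hμμ₀, hμρ, hμmem⟩ := mem_levels_iff.1 hμL
    have hsorted := hL
    rw [← hR, List.append_assoc, List.pairwise_append] at hsorted
    obtain ⟨-, hright, hcross⟩ := hsorted
    -- The list is increasing and exhausts the levels, so every level below `μ` has been processed.
    have hmem : ∀ x ∈ levels f μ₀ ρ, x < μ → x ∈ L' := by
      intro x hx hxμ
      rw [← hlev, ← hR, List.append_assoc, List.mem_append] at hx
      refine hx.resolve_right fun hx => ?_
      rcases List.mem_append.1 hx with hx | hx
      · exact hxμ.ne (List.mem_singleton.1 hx)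
      · exact absurd hxμ (not_lt.2 ((List.pairwise_cons.1 hright).1 x hx).le)
    have hμL' : μ ∉ L' := fun hm => lt_irrefl μ (hcross μ hm μ (by simp))
    have hypos : PosSupport (tail μ₀ c₀ y) := (posSupport_tail_iff h.ne_zero).2
      (hasInitial_runSteps L' fun x hx =>
        (mem_levels_iff.1 ((hlev x).1 (hpre.subset hx))).2.1)
    have hys : ∀ t, (tail μ₀ c₀ y).coeff t ≠ 0 → t ∈ relExpMonoid f μ₀ := by
      intro t ht
      by_cases hm : μ₀ + t ∈ L'
      · exact hws t ((ih t).1 hm ▸ ht)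
      · exact absurd ((ih t).2 hm) ht
    have hyμ : (tail μ₀ c₀ y).coeff (μ - μ₀) = 0 := (ih _).2 (by rwa [add_sub_cancel])
    -- The step divides by `μ - μ_r`, while the equation for the tail has the factor `(μ - μ_r) c₀`;
    -- the `c₀⁻¹` from normalization accounts for the difference.
    have hval : c₀⁻¹ * (rhsCoeff f μ₀ c₀ β y (μ - E.one) / (E.ι μ - resonance f μ₀ c₀ β)) =
        w.coeff (μ - μ₀) := by
      have hk := h.multiplier_ne_zero hρ (s := μ - μ₀) (sub_left_injective.ne hμρ.ne)
      rw [h.rhsCoeff_eq hμ₀ hypos μ hyμ, h.remainder_eq_of_levels hypos hw hys hws hμρ.le hμmem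
        fun t h1 h2 => (ih t).1 (hmem _ h1 h2), ← hsol _ (sub_pos.2 hμμ₀) (sub_lt_sub_right hμρ _)]
      rw [multiplier, add_sub_cancel] at hk ⊢
      have := left_ne_zero_of_mul hk
      have := h.ne_zero
      field_simp
    intro t
    have hcoeff : (tail μ₀ c₀ (runSteps f μ₀ c₀ β (L' ++ [μ]))).coeff t =
        (tail μ₀ c₀ y).coeff t + if μ₀ + t = μ then w.coeff (μ - μ₀) else 0 := by
      rw [runSteps_append_singleton, step, coeff_tail, coeff_tail, HahnSeries.coeff_add,
        ← hval]
      by_cases ht : μ₀ + t = μ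
      · rw [if_pos ht, ht, HahnSeries.coeff_single_same]
        ring
      · rw [if_neg ht, HahnSeries.coeff_single_of_ne ht]
        ring
    rw [hcoeff, List.mem_append, List.mem_singleton]
    by_cases ht : μ₀ + t = μ
    · obtain rfl : t = μ - μ₀ := by rw [← ht]; abel
      rw [if_pos ht, hyμ, zero_add]
      exact ⟨fun _ => rfl, fun hn => absurd (Or.inr ht) hn⟩
    · rw [if_neg ht, add_zero]
      exact ⟨fun hm => (ih t).1 (hm.resolve_right ht), fun hn => (ih t).2 fun hm => hn (Or.inl hm)⟩

/-- Cutting the partial solution at the resonance puts its exponents in the monoid without changing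
the remainders up to there. The finite sum agrees with it on all levels, so both have the same
obstruction at `ρ`. -/
theorem runSteps_spec (h : IsRegular f μ₀ c₀ β (resonance f μ₀ c₀ β)) (hμ₀ : 0 < μ₀)
    {ρ : E.Idx} (hρ : E.ι ρ = resonance f μ₀ c₀ β) {L : List E.Idx} (hL : L.Pairwise (· < ·))
    (hlev : ∀ μ, μ ∈ L ↔ μ ∈ levels f μ₀ ρ) {u : Puiseux E} (hu : PosSupport u)
    (hsol : ∀ s, 0 < s → s < ρ - μ₀ → multiplier μ₀ c₀ (resonance f μ₀ c₀ β) s * u.coeff s =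
      remainder (weight f β) Prod.snd (relExp μ₀) u s) :
    (∀ μ ∈ L, (tail μ₀ c₀ (runSteps f μ₀ c₀ β L)).coeff (μ - μ₀) = u.coeff (μ - μ₀)) ∧
    rhsCoeff f μ₀ c₀ β (runSteps f μ₀ c₀ β L) (ρ - E.one) =
      remainder (weight f β) Prod.snd (relExp μ₀) u (ρ - μ₀) := by
  obtain ⟨w, hw, hws, hwu, hwr⟩ := h.exists_cut hρ hu hsol
  have key := coeff_tail_runSteps h hμ₀ hρ hL hlev hw hws
    (fun s h0 h1 => by rw [hwu s h1, hwr s h1.le, hsol s h0 h1]) L (List.prefix_refl L)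
  have hypos : PosSupport (tail μ₀ c₀ (runSteps f μ₀ c₀ β L)) :=
    (posSupport_tail_iff h.ne_zero).2
      (hasInitial_runSteps L fun x hx => (mem_levels_iff.1 ((hlev x).1 hx)).2.1)
  constructor
  · intro μ hμ
    rw [(key (μ - μ₀)).1 (by rwa [add_sub_cancel]),
      hwu _ (sub_lt_sub_right (mem_levels_iff.1 ((hlev μ).1 hμ)).2.2.1 _)]
  · rw [h.rhsCoeff_eq hμ₀ hypos, h.remainder_eq_of_levels hypos hw ?_ hws le_rfl ?_ ?_,
      hwr _ le_rfl]
    · intro t ht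
      by_cases hm : μ₀ + t ∈ L
      · exact hws t ((key t).1 hm ▸ ht)
      · exact absurd ((key t).2 hm) ht
    · rw [sub_self]
      exact (relExpMonoid f μ₀).zero_mem
    · exact fun t h1 _ => (key t).1 ((hlev _).2 h1)
    · refine (key _).2 fun hm => ?_
      rw [add_sub_cancel, hlev] at hm
      exact lt_irrefl ρ (mem_levels_iff.1 hm).2.2.1

end Resonance

end PuiseuxODE

end

/-! ### The theorem. -/

open PuiseuxODE

theorem mainTheorem5 {K : Type*} [NormedField K] [CharZero K] (E : PuiseuxODE.Exponents K)
    (f : PuiseuxODE.RightSide E) (μ₀ : E.Idx) (c₀ : K) (β : ℚ → K)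
    (h : PuiseuxODE.IsProperInitial f μ₀ c₀ β) :
    -- (i) positive initial exponent, no resonance above it
    (μ₀ ≠ 0 → (¬ ∃ ρ : E.Idx, E.ι ρ = PuiseuxODE.resonance f μ₀ c₀ β ∧ μ₀ < ρ) →
      ∃! y : PuiseuxODE.Puiseux E, PuiseuxODE.IsContinuation f μ₀ c₀ β y) ∧
    -- (ii) resonance outside `i_max`: the coefficient at the resonant index is free
    (μ₀ ≠ 0 → ∀ ρ : E.Idx, E.ι ρ = PuiseuxODE.resonance f μ₀ c₀ β → μ₀ < ρ →
      ρ ∉ PuiseuxODE.iMax f μ₀ →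
      ∀ c : K, ∃! y : PuiseuxODE.Puiseux E,
        PuiseuxODE.IsContinuation f μ₀ c₀ β y ∧ y.coeff ρ = c) ∧
    -- (iii) resonance inside `i_max`: finitely many steps decide the alternative
    (μ₀ ≠ 0 → ∀ ρ : E.Idx, E.ι ρ = PuiseuxODE.resonance f μ₀ c₀ β → μ₀ < ρ →
      ρ ∈ PuiseuxODE.iMax f μ₀ →
      ∃ L : List E.Idx, L.Pairwise (· < ·) ∧ (∀ μ, μ ∈ L ↔ μ ∈ PuiseuxODE.levels f μ₀ ρ) ∧
        (∀ L' : List E.Idx, L' <+: L → ∀ m : E.Idx,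
          (PuiseuxODE.contributions f μ₀ c₀
            (PuiseuxODE.runSteps f μ₀ c₀ β L') m).Finite) ∧
        (∀ y : PuiseuxODE.Puiseux E, PuiseuxODE.IsContinuation f μ₀ c₀ β y →
          ∀ μ ∈ L, y.coeff μ = (PuiseuxODE.runSteps f μ₀ c₀ β L).coeff μ) ∧
        (PuiseuxODE.rhsCoeff f μ₀ c₀ β (PuiseuxODE.runSteps f μ₀ c₀ β L) (ρ - E.one) = 0 →
          ∀ c : K, ∃! y : PuiseuxODE.Puiseux E,
            PuiseuxODE.IsContinuation f μ₀ c₀ β y ∧ y.coeff ρ = c) ∧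
        (PuiseuxODE.rhsCoeff f μ₀ c₀ β (PuiseuxODE.runSteps f μ₀ c₀ β L) (ρ - E.one) ≠ 0 →
          ¬ ∃ y : PuiseuxODE.Puiseux E, PuiseuxODE.IsContinuation f μ₀ c₀ β y)) ∧
    -- (iv) constant initial term
    (μ₀ = 0 → ∃! y : PuiseuxODE.Puiseux E, PuiseuxODE.IsContinuation f μ₀ c₀ β y) := by
  obtain ⟨hc, -, ⟨rfl, hν, hd⟩ | ⟨hμ, hcv, -, hv⟩⟩ := h
  · refine ⟨fun h => absurd rfl h, fun h => absurd rfl h, fun h => absurd rfl h, fun _ => ?_⟩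
    refine (isRegular_zero hc hν hd).existsUnique_of_not_resonant fun ρ hρ h0 => hρ.ne ?_
    exact E.ι_injective ((map_zero E.ι).trans h0.symm)
  have hreg := isRegular_of_pos hc hμ hcv hv
  refine ⟨fun _ h => hreg.existsUnique_of_not_resonant fun ρ h1 h2 => h ⟨ρ, h2, h1⟩,
    fun _ ρ hρ hlt hn c => hreg.existsUnique_of_notMem_monoid hρ hlt (fun hm => hn ?_) c, ?_,
    fun h => absurd h hμ.ne'⟩
  · simpa using add_mem_iMax_of_mem_monoid hm (sub_ne_zero.2 hlt.ne')
  intro _ ρ hρ hlt _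
  have hfin := hreg.finite_levels ρ
  have hL : (hfin.toFinset.sort (· ≤ ·)).Pairwise (· < ·) := (Finset.sortedLT_sort _).pairwise
  have hlev : ∀ μ, μ ∈ hfin.toFinset.sort (· ≤ ·) ↔ μ ∈ levels f μ₀ ρ := fun μ => by
    rw [Finset.mem_sort, Set.Finite.mem_toFinset]
  refine ⟨_, hL, hlev, ?_, ?_, ?_, ?_⟩
  · intro L' hL' m
    exact finite_contributions f hμ ((posSupport_tail_iff hc).2 (hasInitial_runSteps L' fun x hx =>
      (mem_levels_iff.1 ((hlev x).1 (hL'.subset hx))).2.1)) m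
  · intro y hy μ hmem
    obtain ⟨hy1, hy2⟩ := hreg.isContinuation_iff.1 hy
    have hne : μ ≠ μ₀ := (mem_levels_iff.1 ((hlev μ).1 hmem)).2.1.ne'
    rw [coeff_eq_of_tail_of_ne hc y hne, coeff_eq_of_tail_of_ne hc _ hne,
      (runSteps_spec hreg hμ hρ hL hlev hy1 fun s h0 _ => hy2 s h0).1 μ hmem]
  · intro h0
    refine hreg.existsUnique_of_resonant hρ hlt fun u hu hsol => ?_
    rw [← (runSteps_spec hreg hμ hρ hL hlev hu hsol).2, h0]
  · rintro h0 ⟨y, hy⟩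
    obtain ⟨hy1, hy2⟩ := hreg.isContinuation_iff.1 hy
    -- A continuation satisfies the equation at `ρ` too, where the multiplier is zero, so the
    -- obstruction would have to vanish.
    rw [(runSteps_spec hreg hμ hρ hL hlev hy1 fun s h0 _ => hy2 s h0).2,
      ← hy2 _ (sub_pos.2 hlt), multiplier, add_sub_cancel, hρ, sub_self, zero_mul, zero_mul] at h0
    exact h0 rfl
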